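/- Let $p$ be a prime, $n$ a positive integer, and let $S_n$ act on $\{1,\dots,n\}$ from the right (products of permutations are read from left to right). Put $\sigma_k=(k-1,k)$ for $2\le k\le n$ and let $L_k=\sum_{i<k}(i,k)$ for $1\le k\le n$ be the Jucys–Murphy elements. For a tableau $t$ with $n$ boxes let $r_t(k)=j-i$ be the content of the node $[i,j]$ containing $k$, and write $t\sim_p s$ if $r_t(k)\equiv r_s(k) \bmod p$ for all $k$; the tableau class $[t]$ of $t$ is the set of all standard tableaux $s$ (of any shape with $n$ boxes) with $s\sim_p t$. Put $$E_t=\prod_{-n<c<n}\ \prod_{i:\ r_t(i)\neq c}\frac{L_i-c}{r_t(i)-c}\in\mathbb Q S_n,\qquad E_T=\sum_{t\in T}E_t \text{ for a tableau class } T .$$ Then every $E_T$ has coefficients in $\mathbb Z_{(p)}$, so that $E_T$ can be regarded as an element of $\mathbb F_pS_n$. Moreover, put $h_L(k)=L_k-L_{k-1}\in\mathbb F_pS_n$. If $U$ is a tableau class and $u\in U$ satisfies $\alpha:=r_u(k)-r_u(k-1)\not\equiv 0 \bmod p$, then $h_L(k)-\alpha$ acts (by left multiplication) nilpotently on $E_U\mathbb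 F_pS_n$, so $h_L(k)$ is invertible there, with inverse the finite geometric series $\sum_{i\ge0}\alpha^{-i-1}(\alpha-h_L(k))^i$. Let $\frac1{h_L(k)}\in\mathbb F_pS_n$ be the element which acts as this inverse on $E_U\mathbb F_pS_n$ for each such $U$, and as $0$ on $E_U\mathbb F_pS_n$ for the remaining classes $U$. Let $t$ be a standard $\lambda$-tableau with class $T=[t]$, let $t^\lambda$ be the $\lambda$-tableau filled with $1,\dots,n$ along rows, $T^\lambda=[t^\lambda]$, and let $d(t)\in S_n$ be given by $t^\lambda d(t)=t$. Let $d(t)=\sigma_{i_1}\sigma_{i_2}\cdots\sigma_{i_N}$ be any reduced expression, and put $t_1=t^\lambda$, $t_{j+1}=t_j\sigma_{i_j}$, so that $t_{N+1}=t$. Define $$\Psi_{L,d(t)}=\Bigl(\sigma_{i_1}-\tfrac1{h_L(i_1)}\Bigr)\Bigl(\sigma_{i_2}-\tfrac1{h_L(i_2)}\Bigr)\cdots\Bigl(\sigma_{i_N}-\tfrac1{h_L(i_N)}\Bigr),$$ where $\frac1{h_L(i_j)}$ in the $j$-th factor is replaced by $1$ if $[t_{j+1}]=[t_j]$. Then all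 $t_j$ are standard; if $[t_{j+1}]\ne[t_j]$, then $r_{t_{j+1}}(i_j)\not\equiv r_{t_{j+1}}(i_j-1)\bmod p$, so that $h_L(i_j)$ is invertible on $E_{[t_{j+1}]}\mathbb F_pS_n$; the $j$-th factor maps $E_{[t_{j+1}]}\mathbb F_pS_n$ into $E_{[t_j]}\mathbb F_pS_n$; and $$E_{T^\lambda}\,\Psi_{L,d(t)}=\Psi_{L,d(t)}\,E_T\qquad\text{in }\mathbb F_pS_n .$$ -/

import Mathlib

noncomputable section

open scoped Classical

namespace ModularMurphy

/-! ### Tableaux -/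

/-- The symmetric group on `n` letters with products read from left to right, so that it acts on
letters and on tableaux from the right. The letters `1, ..., n` are the elements `0, ..., n - 1` of
`Fin n`. -/
abbrev SymGrp (n : ℕ) : Type := (Equiv.Perm (Fin n))ᵐᵒᵖ

/-- A tableau with `n` boxes, of any shape: a Young diagram (English notation, the cell `(i, j)` is
in row `i` and column `j`, counted from `0`) filled with the `n` letters, each used once. -/
@[ext]
structure Tableau (n : ℕ) where
  shape : YoungDiagram
  entry : {x // x ∈ shape.cells} ≃ Fin n

namespace Tableau

variable {n : ℕ}

/-- The cell that holds the letter `k`. -/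
def cell (t : Tableau n) (k : Fin n) : ℕ × ℕ := (t.entry.symm k).1

/-- The content `j - i` of the cell `(i, j)` that holds the letter `k`. -/
def content (t : Tableau n) (k : Fin n) : ℤ := ((t.cell k).2 : ℤ) - ((t.cell k).1 : ℤ)

/-- Entries increase along rows and down columns. -/
def IsStandard (t : Tableau n) : Prop :=
  ∀ x y : {x // x ∈ t.shape.cells},
    (y.1 = (x.1.1, x.1.2 + 1) ∨ y.1 = (x.1.1 + 1, x.1.2)) → t.entry x ≤ t.entry y

/-- The right action of the symmetric group on tableaux, through the entries. -/
def act (t : Tableau n) (g : SymGrp n) : Tableau n := ⟨t.shape, t.entry.trans g.unop⟩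

/-- The shape of a tableau with `n` boxes has `n` cells. -/
theorem card_cells (t : Tableau n) : t.shape.cells.card = n := by
  simpa using Fintype.card_congr t.entry

/-- The cells of a diagram, in the order of reading: row by row, each row from left to right. -/
def readingCells (μ : YoungDiagram) : Finset (ℕ ×ₗ ℕ) := μ.cells.map toLex.toEmbedding

/-- The cells as a subtype of the lexicographically ordered pairs. -/
def cellsEquivReading (μ : YoungDiagram) : {x // x ∈ μ.cells} ≃ {x // x ∈ readingCells μ} :=
  toLex.subtypeEquiv (by intro a; simp [readingCells])

/-- The filling of the cells of the shape of `t` in which the letters are filled in along the rows,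
in increasing order. -/
def readingEntry (t : Tableau n) : {x // x ∈ t.shape.cells} ≃ Fin n :=
  (cellsEquivReading t.shape).trans
    ((readingCells t.shape).orderIsoOfFin
      (by simpa [readingCells] using t.card_cells)).symm.toEquiv

/-- The tableau `t^λ`, for `λ` the shape of `t`: the letters are filled in along the rows. -/
def highest (t : Tableau n) : Tableau n := ⟨t.shape, t.readingEntry⟩

/-- The permutation `d(t)`, with `t^λ d(t) = t`. -/
def d (t : Tableau n) : SymGrp n := MulOpposite.op (t.readingEntry.symm.trans t.entry)

theorem highest_act_d (t : Tableau n) : t.highest.act t.d = t := by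
  have h : t.readingEntry.trans (t.readingEntry.symm.trans t.entry) = t.entry := by
    ext x; simp
  exact congrArg (fun e => (⟨t.shape, e⟩ : Tableau n)) h

theorem cell_lt (t : Tableau n) (k : Fin n) : (t.cell k).1 < n ∧ (t.cell k).2 < n := by
  have hm : ((t.cell k).1, (t.cell k).2) ∈ t.shape := (t.entry.symm k).2
  constructor
  · have h1 : (t.shape.col (t.cell k).2).card ≤ t.shape.cells.card :=
      Finset.card_le_card (Finset.filter_subset _ _)
    rw [← YoungDiagram.colLen_eq_card, t.card_cells] at h1
    exact lt_of_lt_of_le (YoungDiagram.mem_iff_lt_colLen.1 hm) h1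
  · have h1 : (t.shape.row (t.cell k).1).card ≤ t.shape.cells.card :=
      Finset.card_le_card (Finset.filter_subset _ _)
    rw [← YoungDiagram.rowLen_eq_card, t.card_cells] at h1
    exact lt_of_lt_of_le (YoungDiagram.mem_iff_lt_rowLen.1 hm) h1

theorem cell_injective : Function.Injective (cell : Tableau n → Fin n → ℕ × ℕ) := by
  rintro ⟨μ, e⟩ ⟨ν, f⟩ h
  have key : ∀ k, (e.symm k).1 = (f.symm k).1 := fun k => congrFun h k
  have hs : μ = ν := by
    ext x
    constructor
    · intro hx
      have := key (e ⟨x, hx⟩)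
      rw [Equiv.symm_apply_apply] at this
      simp only at this
      rw [this]; exact (f.symm _).2
    · intro hx
      have := key (f ⟨x, hx⟩)
      rw [Equiv.symm_apply_apply] at this
      simp only at this
      rw [← this]; exact (e.symm _).2
  subst hs
  have : e.symm = f.symm := Equiv.ext fun k => Subtype.ext (key k)
  rw [Equiv.symm_bijective.injective this]

/-- There are finitely many tableaux with `n` boxes. -/
instance : Finite (Tableau n) := by
  refine Finite.of_injective
    (fun (t : Tableau n) (k : Fin n) =>
      ((⟨(t.cell k).1, (t.cell_lt k).1⟩, ⟨(t.cell k).2, (t.cell_lt k).2⟩) : Fin n × Fin n)) ?_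
  intro s t h
  apply cell_injective
  funext k
  have := congrFun h k
  simp only [Prod.mk.injEq, Fin.mk.injEq] at this
  exact Prod.ext this.1 this.2

instance : Fintype (Tableau n) := Fintype.ofFinite _

/-- The relation `t ∼_p s`: every letter has the same content mod `p` in `t` and in `s`. -/
def Equivalent (p : ℕ) (t s : Tableau n) : Prop :=
  ∀ k, t.content k ≡ s.content k [ZMOD p]

/-- The tableau class `[t]`, which consists of standard tableaux. -/
def cls (p : ℕ) (t : Tableau n) : Finset (Tableau n) :=
  Finset.univ.filter fun s => s.IsStandard ∧ Equivalent p t s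

end Tableau

/-- The set of all tableau classes. -/
def tableauClasses (p n : ℕ) : Finset (Finset (Tableau n)) :=
  (Finset.univ.filter fun t : Tableau n => t.IsStandard).image (Tableau.cls p)

/-- The integer `r_T(k)`: the content of `k` in an arbitrarily chosen element of `T`, well defined
mod `p` on a tableau class. -/
def classContent {n : ℕ} (T : Finset (Tableau n)) (k : Fin n) : ℤ :=
  if h : T.Nonempty then h.choose.content k else 0

/-! ### Simple transpositions and reduced words -/

/-- The letter moved by the simple transposition number `i` that comes first. -/
def lo {n : ℕ} (i : Fin (n - 1)) : Fin n := ⟨i, by omega⟩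

/-- The letter moved by the simple transposition number `i` that comes second. -/
def hi {n : ℕ} (i : Fin (n - 1)) : Fin n := ⟨i + 1, by omega⟩

/-- The simple transposition `σ_k = (k - 1, k)`, with `k - 1 = lo i` and `k = hi i`. -/
def simple {n : ℕ} (i : Fin (n - 1)) : SymGrp n := MulOpposite.op (Equiv.swap (lo i) (hi i))

/-- `w` is a reduced expression of `g`: the product of the simple transpositions in `w`, in this
order, is `g`, and no shorter word has this property. -/
def IsReducedWord {n : ℕ} (w : List (Fin (n - 1))) (g : SymGrp n) : Prop :=
  (w.map simple).prod = g ∧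
    ∀ w' : List (Fin (n - 1)), (w'.map simple).prod = g → w.length ≤ w'.length

/-! ### Jucys-Murphy elements and idempotents -/

/-- The Jucys-Murphy element `L_k = (1, k) + (2, k) + ... + (k - 1, k)`. -/
def jucysMurphy (K : Type) [CommRing K] {n : ℕ} (k : Fin n) : MonoidAlgebra K (SymGrp n) :=
  ∑ i ∈ Finset.univ.filter (fun i : Fin n => i < k),
    MonoidAlgebra.single (MulOpposite.op (Equiv.swap i k)) 1

/-- The Jucys-Murphy idempotent `E_t`, the product of `(L_i - c) / (r_t(i) - c)` over all integers
`-n < c < n` and all letters `i` with `r_t(i) ≠ c`. (The factors commute; they are multiplied here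
in increasing order.) -/
def jmIdempotent {n : ℕ} (t : Tableau n) : MonoidAlgebra ℚ (SymGrp n) :=
  (((Finset.Ioo (-(n : ℤ)) n).sort (· ≤ ·)).map fun c =>
    (((List.finRange n).filter fun i => t.content i ≠ c).map fun i =>
      ((t.content i : ℚ) - (c : ℚ))⁻¹ •
        (jucysMurphy ℚ i - algebraMap ℚ (MonoidAlgebra ℚ (SymGrp n)) (c : ℚ))).prod).prod

/-- The element `E_T = ∑_{t ∈ T} E_t` of the rational group algebra. -/
def classIdempotentQ {n : ℕ} (T : Finset (Tableau n)) : MonoidAlgebra ℚ (SymGrp n) :=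
  ∑ t ∈ T, jmIdempotent t

/-- All coefficients lie in the localization of `ℤ` at `(p)`. -/
def IsPIntegral (p : ℕ) {n : ℕ} (x : MonoidAlgebra ℚ (SymGrp n)) : Prop :=
  ∀ g, ¬ p ∣ (x.coeff g).den

section ModP

variable (p : ℕ) [Fact p.Prime] {n : ℕ}

/-- Reduction mod `p` of the coefficients: `a / b` with `p ∤ b` goes to the quotient of the residue
classes of `a` and `b`. Only meaningful for elements with `IsPIntegral p`. -/
def reduceMod (x : MonoidAlgebra ℚ (SymGrp n)) : MonoidAlgebra (ZMod p) (SymGrp n) :=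
  ∑ g : Equiv.Perm (Fin n), MonoidAlgebra.single (MulOpposite.op g)
    ((x.coeff (MulOpposite.op g) : ℚ) : ZMod p)

/-- The element `E_T`, reduced mod `p`. -/
def classIdempotent (T : Finset (Tableau n)) : MonoidAlgebra (ZMod p) (SymGrp n) :=
  reduceMod p (classIdempotentQ T)

/-- The subspace `E_T (𝔽_p S_n)` of `𝔽_p S_n`. -/
def classSpace (T : Finset (Tableau n)) : Submodule (ZMod p) (MonoidAlgebra (ZMod p) (SymGrp n)) :=
  LinearMap.range (LinearMap.mulLeft (ZMod p) (classIdempotent p T))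

/-- The element `h_L(k) = L_k - L_{k-1}`, for `k = hi i`. -/
def hL (i : Fin (n - 1)) : MonoidAlgebra (ZMod p) (SymGrp n) :=
  jucysMurphy (ZMod p) (hi i) - jucysMurphy (ZMod p) (lo i)

/-- The scalar `r_T(k) - r_T(k-1)` mod `p`, for `k = hi i`. -/
def classStep (T : Finset (Tableau n)) (i : Fin (n - 1)) : ZMod p :=
  ((classContent T (hi i) - classContent T (lo i) : ℤ) : ZMod p)

/-- The geometric series of `1 / x = 1 / (α - (α - x))`, cut off after `m` terms. It is the inverse
of `x` wherever `(x - α) ^ m = 0` and `α ≠ 0`. -/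
def geomInverse (x : MonoidAlgebra (ZMod p) (SymGrp n)) (α : ZMod p) (m : ℕ) :
    MonoidAlgebra (ZMod p) (SymGrp n) :=
  ∑ i ∈ Finset.range m,
    (α⁻¹) ^ (i + 1) • (algebraMap (ZMod p) (MonoidAlgebra (ZMod p) (SymGrp n)) α - x) ^ i

/-- The least `m` such that `(x - α) ^ m` acts by zero on `E_T (𝔽_p S_n)`. -/
def nilIndex (x : MonoidAlgebra (ZMod p) (SymGrp n)) (α : ZMod p) (T : Finset (Tableau n)) : ℕ :=
  sInf {m : ℕ | ∀ v ∈ classSpace p T,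
    (x - algebraMap (ZMod p) (MonoidAlgebra (ZMod p) (SymGrp n)) α) ^ m * v = 0}

/-- The element `1 / h_L(k)`, `k = hi i`: on each `E_T (𝔽_p S_n)` with `r_T(k) ≢ r_T(k-1)` mod `p`
it acts (by left multiplication) as the finite geometric series for the inverse of `h_L(k)`; on the
other ones, where `h_L(k)` is nilpotent, as zero. -/
def invHL (i : Fin (n - 1)) : MonoidAlgebra (ZMod p) (SymGrp n) :=
  ∑ T ∈ (tableauClasses p n).filter (fun T => classStep p T i ≠ 0),
    geomInverse p (hL p i) (classStep p T i) (nilIndex p (hL p i) (classStep p T i) T) *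
      classIdempotent p T

/-- The factor `σ_k - 1 / h_L(k)`, `k = hi i`, for the step from `u` to `u σ_k`; here `1 / h_L(k)`
is set to `1` if `[u] = [u σ_k]`. -/
def intertwiner (u : Tableau n) (i : Fin (n - 1)) : MonoidAlgebra (ZMod p) (SymGrp n) :=
  MonoidAlgebra.single (simple i) 1 -
    if Tableau.Equivalent p u (u.act (simple i)) then 1 else invHL p i

/-- The product of the intertwiners along the word `w`, where the tableaux `t_1 = u`,
`t_{j+1} = t_j σ_{i_j}` run along with the word. -/
def intertwinerProd : Tableau n → List (Fin (n - 1)) → MonoidAlgebra (ZMod p) (SymGrp n)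
  | _, [] => 1
  | u, i :: w => intertwiner p u i * intertwinerProd (u.act (simple i)) w

end ModP

end ModularMurphy

end

/-! Over `ℚ` everything follows from a description of the joint spectrum of the Jucys–Murphy
elements. On the regular representation they act by commuting symmetric operators, hence are
simultaneously diagonalizable. The relations between `L_{k-1}`, `L_k` and `σ_k`, used locally in the
manner of Okounkov and Vershik, force every joint eigenvalue sequence to be the content sequence of
a standard tableau. Since contents determine a standard tableau, identities can be tested on joint
eigenvectors (`eq_zero_of_forall_eigenvector`): the `E_t` are orthogonal idempotents with sum 1, and
`E_s σ_k E_t = 0` unless the contents of `s` and `t` agree, possibly after exchanging `k - 1` and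
`k`.

For integrality, take an integral polynomial in the `L_k` whose eigenvalues are prime to `p` on the
class `T` and divisible by `p` off it. Its power of exponent `p^M (p - 1)` has eigenvalues congruent
to 1 or 0 mod `p^M`; if `p^M` clears the `p`-denominators of all `E_t`, then `E_T` differs from this
power by a `p`-integral element. The relation `Reduces` carries rational identities to `𝔽_p`.

Mod `p`, let `e_u` and `e_v` be the idempotents of the classes of `u` and `v = u σ_k`. If the
classes coincide, `σ_k` commutes with `e_u`. Otherwise only two blocks survive in each of `e_u σ_k =
e_u σ_k e_u + e_u σ_k e_v` and `σ_k e_v = e_u σ_k e_v + e_v σ_k e_v`. A diagonal block `x = e σ_k e`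
solves the Sylvester equation `L_k x - x L_{k-1} = e`, which has one solution in the corner of `e`
because the residues at `k - 1` and `k` differ, namely `(1 / h_L(k)) e`. Hence `e_u (σ_k - 1/h_L(k))
= e_u σ_k e_v = (σ_k - 1/h_L(k)) e_v`, and these relations compose along the word. The intermediate
tableaux are standard because each letter of a reduced expression of `d(t)` exchanges letters that
are not neighbours in the tableau. -/

namespace ModularMurphy

/-! ### Relations between Jucys–Murphy elements and simple transpositions, over any commutative
ring. -/

section Relations

variable {K : Type} [CommRing K] {n : ℕ}

/-- Conjugation by `g` only permutes the summands `(b, j)` with `b < j`. -/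
theorem single_mul_jucysMurphy (g : Equiv.Perm (Fin n)) (j : Fin n) (hj : g j = j)
    (hg : ∀ b, g b < j ↔ b < j) :
    MonoidAlgebra.single (MulOpposite.op g) (1 : K) * jucysMurphy K j =
      jucysMurphy K j * MonoidAlgebra.single (MulOpposite.op g) (1 : K) := by
  unfold jucysMurphy
  rw [Finset.mul_sum, Finset.sum_mul]
  simp only [MonoidAlgebra.single_mul_single, ← MulOpposite.op_mul, mul_one]
  symm
  refine Finset.sum_nbij' (fun b => g b) (fun b => g.symm b) ?_ ?_ ?_ ?_ ?_
  · intro b hb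
    simpa [hg] using hb
  · intro b hb
    have := hg (g.symm b)
    simp_all
  · simp
  · simp
  · intro b _
    rw [Equiv.mul_swap_eq_swap_mul, hj]

theorem commute_jucysMurphy (i j : Fin n) : Commute (jucysMurphy K i) (jucysMurphy K j) := by
  wlog h : i < j generalizing i j
  · rcases eq_or_lt_of_le (not_lt.1 h) with h | h
    · rw [h]
    · exact (this j i h).symm
  · change _ * _ = _ * _
    conv_lhs => rw [jucysMurphy]
    conv_rhs => enter [2]; rw [jucysMurphy]
    rw [Finset.mul_sum, Finset.sum_mul]
    refine Finset.sum_congr rfl fun a ha => ?_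
    have ha : a < i := by simpa using ha
    refine single_mul_jucysMurphy _ _ (Equiv.swap_apply_of_ne_of_ne (by order) (by order)) ?_
    intro b
    rw [Equiv.swap_apply_def]
    split_ifs with h1 h2
    · subst h1; exact ⟨fun _ => by order, fun _ => h⟩
    · subst h2; exact ⟨fun _ => by order, fun _ => by order⟩
    · rfl

theorem lo_lt_hi (i : Fin (n - 1)) : lo i < hi i := by simp [lo, hi, Fin.lt_def]

theorem lo_ne_hi (i : Fin (n - 1)) : lo i ≠ hi i := (lo_lt_hi i).ne

theorem lt_hi_iff (i : Fin (n - 1)) (b : Fin n) : b < hi i ↔ b < lo i ∨ b = lo i := by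
  simp only [lo, hi, Fin.lt_def, Fin.ext_iff]; omega

/-- The simple transposition as an element of the group algebra. -/
noncomputable def simpleElt (K : Type) [CommRing K] (i : Fin (n - 1)) :
    MonoidAlgebra K (SymGrp n) :=
  MonoidAlgebra.single (simple i) 1

theorem simpleElt_mul_self (i : Fin (n - 1)) : simpleElt K i * simpleElt K i = 1 := by
  simp [simpleElt, simple, MonoidAlgebra.single_mul_single, ← MulOpposite.op_mul,
    MonoidAlgebra.one_def]

theorem simpleElt_commute_jucysMurphy (i : Fin (n - 1)) (j : Fin n) (h1 : j ≠ lo i)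
    (h2 : j ≠ hi i) : Commute (simpleElt K i) (jucysMurphy K j) := by
  refine single_mul_jucysMurphy _ _ (Equiv.swap_apply_of_ne_of_ne h1 h2) ?_
  intro b
  rw [Equiv.swap_apply_def]
  simp only [lo, hi, Fin.lt_def, Fin.ext_iff, ne_eq] at *
  split_ifs with h3 h4 <;> simp_all <;> omega

/-- Conjugating `L_{k-1}` by `σ_k` gives every summand of `L_k` except `σ_k` itself. This is the
relation of the degenerate affine Hecke algebra. -/
theorem simpleElt_mul_jucysMurphy_lo (i : Fin (n - 1)) :
    simpleElt K i * jucysMurphy K (lo i) = jucysMurphy K (hi i) * simpleElt K i - 1 := by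
  have h : (Finset.univ.filter fun b : Fin n => b < hi i) =
      insert (lo i) (Finset.univ.filter fun b : Fin n => b < lo i) := by
    ext b; simp [lt_hi_iff, or_comm]
  have h2 : jucysMurphy K (hi i) = simpleElt K i + ∑ b ∈ Finset.univ.filter (fun b => b < lo i),
      MonoidAlgebra.single (MulOpposite.op (Equiv.swap b (hi i))) 1 := by
    rw [jucysMurphy, h, Finset.sum_insert (by simp)]; rfl
  rw [h2, add_mul, simpleElt_mul_self, add_sub_cancel_left, jucysMurphy, Finset.mul_sum,
    Finset.sum_mul]
  refine Finset.sum_congr rfl fun b hb => ?_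
  have hb : b < lo i := by simpa using hb
  have hb' : b < hi i := hb.trans (lo_lt_hi i)
  simp only [simpleElt, simple, MonoidAlgebra.single_mul_single, ← MulOpposite.op_mul, mul_one]
  rw [Equiv.mul_swap_eq_swap_mul (Equiv.swap (lo i) (hi i)),
    Equiv.swap_apply_of_ne_of_ne hb.ne hb'.ne, Equiv.swap_apply_right]

theorem simpleElt_mul_jucysMurphy_hi (i : Fin (n - 1)) :
    simpleElt K i * jucysMurphy K (hi i) = jucysMurphy K (lo i) * simpleElt K i + 1 := by
  have h := simpleElt_mul_jucysMurphy_lo (K := K) i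
  have h1 : simpleElt K i * (simpleElt K i * jucysMurphy K (lo i)) * simpleElt K i =
      simpleElt K i * (jucysMurphy K (hi i) * simpleElt K i - 1) * simpleElt K i := by rw [h]
  rw [← mul_assoc, simpleElt_mul_self, one_mul, mul_sub, sub_mul, mul_one, simpleElt_mul_self,
    ← mul_assoc, mul_assoc, simpleElt_mul_self, mul_one] at h1
  rw [h1, sub_add_cancel]

theorem jucysMurphy_zero (k : Fin n) (hk : (k : ℕ) = 0) : jucysMurphy K k = 0 := by
  have : (Finset.univ.filter fun b : Fin n => b < k) = ∅ := by
    ext b; simp [Fin.lt_def, hk]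
  rw [jucysMurphy, this, Finset.sum_empty]

theorem simpleElt_braid (i j : Fin (n - 1)) (h : (j : ℕ) = i + 1) :
    simpleElt K i * simpleElt K j * simpleElt K i =
      simpleElt K j * simpleElt K i * simpleElt K j := by
  have hl : lo j = hi i := by simp [lo, hi, h]
  have h1 : lo i ≠ hi i := lo_ne_hi i
  have h2 : hi i ≠ hi j := hl ▸ lo_ne_hi j
  have h3 : lo i ≠ hi j := by simp only [lo, hi, ne_eq, Fin.ext_iff]; omega
  simp only [simpleElt, simple, MonoidAlgebra.single_mul_single, ← MulOpposite.op_mul, mul_one]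
  congr 2
  rw [hl, ← mul_assoc, ← mul_assoc]
  have e := Equiv.swap_mul_swap_mul_swap h2.symm h3.symm
  have e' := Equiv.swap_mul_swap_mul_swap h1 h3
  rw [Equiv.swap_comm (hi j) (hi i), Equiv.swap_comm (hi i) (lo i)] at e
  rw [e, e', Equiv.swap_comm]

end Relations

/-! ### Combinatorics of the joint spectrum: from local conditions to content sequences. -/

/-- A family of sequences of length `n`, closed under admissible transpositions, with the local
properties of the joint spectrum of the Jucys-Murphy elements. -/
structure SpectralFamily (n : ℕ) (C : Set (ℕ → ℝ)) : Prop where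
  zero : ∀ a ∈ C, 0 < n → a 0 = 0
  ne : ∀ a ∈ C, ∀ i, i + 1 < n → a (i + 1) ≠ a i
  swap : ∀ a ∈ C, ∀ i, i + 1 < n → a (i + 1) ≠ a i + 1 → a (i + 1) ≠ a i - 1 →
    a ∘ Equiv.swap i (i + 1) ∈ C
  braid : ∀ a ∈ C, ∀ i, i + 2 < n → (a (i + 1) = a i + 1 ∨ a (i + 1) = a i - 1) → a (i + 2) ≠ a i

namespace SpectralFamily

variable {n : ℕ} {C : Set (ℕ → ℝ)}

/-- Without an earlier neighbour, the value at `q` could be moved by admissible swaps to position 0,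
where it would be 0 and stand next to the old initial 0. -/
theorem exists_neighbour_lt (hC : SpectralFamily n C) (q : ℕ) : ∀ a ∈ C, 0 < q → q < n →
    ∃ m < q, a m = a q + 1 ∨ a m = a q - 1 := by
  induction q with
  | zero => intro a _ h; omega
  | succ q ih =>
    intro a ha _ hq
    by_cases h1 : a (q + 1) = a q + 1
    · exact ⟨q, by omega, Or.inr (by linarith)⟩
    by_cases h2 : a (q + 1) = a q - 1
    · exact ⟨q, by omega, Or.inl (by linarith)⟩
    have hs := hC.swap a ha q hq h1 h2
    have e1 : (a ∘ Equiv.swap q (q + 1)) q = a (q + 1) := by simp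
    rcases Nat.eq_zero_or_pos q with rfl | hq0
    · have := hC.zero _ hs (by omega)
      have h0 := hC.zero a ha (by omega)
      exact absurd (by rw [← e1, this, h0]) (hC.ne a ha 0 hq)
    · obtain ⟨m, hm, h⟩ := ih _ hs hq0 (by omega)
      rw [e1] at h
      refine ⟨m, by omega, ?_⟩
      rwa [Function.comp_apply, Equiv.swap_apply_of_ne_of_ne (by omega) (by omega)] at h

/-- Induction on the distance of the two equal entries: an endpoint whose inner neighbour does not
differ from it by 1 is swapped inwards. What remains is the case where both inner neighbours differ
by 1 from the common value. -/
theorem exists_between (hC : SpectralFamily n C) (d : ℕ) : ∀ a ∈ C, ∀ p q, p < q → q < n →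
    q - p ≤ d → a p = a q →
    (∃ m, p < m ∧ m < q ∧ a m = a p + 1) ∧ (∃ m, p < m ∧ m < q ∧ a m = a p - 1) := by
  induction d with
  | zero => intro a _ p q h1 h2 h3; omega
  | succ d ih =>
    intro a ha p q hpq hq hd he
    have hne1 : p + 1 ≠ q := by
      rintro rfl; exact hC.ne a ha p hq he.symm
    by_cases hp : a (p + 1) = a p + 1 ∨ a (p + 1) = a p - 1
    swap
    · push Not at hp
      have hs := hC.swap a ha p (by omega) hp.1 hp.2
      have ev : ∀ m, p + 1 < m → (a ∘ Equiv.swap p (p + 1)) m = a m := fun m hm => by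
        rw [Function.comp_apply, Equiv.swap_apply_of_ne_of_ne (by omega) (by omega)]
      have e1 : (a ∘ Equiv.swap p (p + 1)) (p + 1) = a p := by simp
      obtain ⟨⟨m, h1, h2, h3⟩, ⟨m', h1', h2', h3'⟩⟩ :=
        ih _ hs (p + 1) q (by omega) hq (by omega) (by rw [e1, ev q (by omega), he])
      rw [e1, ev _ h1] at h3
      rw [e1, ev _ h1'] at h3'
      exact ⟨⟨m, by omega, h2, h3⟩, ⟨m', by omega, h2', h3'⟩⟩
    obtain ⟨r, rfl⟩ : ∃ r, q = r + 1 := ⟨q - 1, by omega⟩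
    by_cases hr : a (r + 1) = a r + 1 ∨ a (r + 1) = a r - 1
    swap
    · push Not at hr
      have hs := hC.swap a ha r (by omega) hr.1 hr.2
      have ev : ∀ m, m < r → (a ∘ Equiv.swap r (r + 1)) m = a m := fun m hm => by
        rw [Function.comp_apply, Equiv.swap_apply_of_ne_of_ne (by omega) (by omega)]
      have e1 : (a ∘ Equiv.swap r (r + 1)) r = a (r + 1) := by simp
      obtain ⟨⟨m, h1, h2, h3⟩, ⟨m', h1', h2', h3'⟩⟩ :=
        ih _ hs p r (by omega) (by omega) (by omega) (by rw [e1, ev p (by omega), he])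
      rw [ev p (by omega), ev _ h2] at h3
      rw [ev p (by omega), ev _ h2'] at h3'
      exact ⟨⟨m, by omega, by omega, h3⟩, ⟨m', by omega, by omega, h3'⟩⟩
    have hpr : p + 1 ≠ r := by
      rintro rfl
      exact hC.braid a ha p hq hp he.symm
    -- A further occurrence of the value strictly in between shortens the interval. If the two inner
    -- neighbours are equal, the induction hypothesis applied to them supplies such an occurrence;
    -- if they are different, they are the two required entries.
    have split : ∀ m, p < m → m < r + 1 → a m = a p →
        (∃ m, p < m ∧ m < r + 1 ∧ a m = a p + 1) ∧
          (∃ m, p < m ∧ m < r + 1 ∧ a m = a p - 1) := by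
      intro m h1 h2 h3
      obtain ⟨⟨x, x1, x2, x3⟩, ⟨y, y1, y2, y3⟩⟩ := ih a ha p m h1 (by omega) (by omega) h3.symm
      exact ⟨⟨x, x1, by omega, x3⟩, ⟨y, y1, by omega, y3⟩⟩
    rcases hp with hp | hp <;> rcases hr with hr | hr
    · exact ⟨⟨p + 1, by omega, by omega, hp⟩, ⟨r, by omega, by omega, by linarith⟩⟩
    · obtain ⟨-, ⟨y, y1, y2, y3⟩⟩ := ih a ha (p + 1) r (by omega) (by omega) (by omega)
        (by linarith)
      exact split y (by omega) (by omega) (by linarith)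
    · obtain ⟨⟨y, y1, y2, y3⟩, -⟩ := ih a ha (p + 1) r (by omega) (by omega) (by omega)
        (by linarith)
      exact split y (by omega) (by omega) (by linarith)
    · exact ⟨⟨r, by omega, by omega, by linarith⟩, ⟨p + 1, by omega, by omega, hp⟩⟩

theorem exists_int (hC : SpectralFamily n C) {a : ℕ → ℝ} (ha : a ∈ C) (q : ℕ) (hq : q < n) :
    ∃ z : ℤ, a q = z := by
  induction q using Nat.strong_induction_on with
  | _ q ih =>
    rcases Nat.eq_zero_or_pos q with rfl | h0
    · exact ⟨0, by simpa using hC.zero a ha hq⟩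
    · obtain ⟨m, hm, h⟩ := hC.exists_neighbour_lt q a ha h0 hq
      obtain ⟨z, hz⟩ := ih m hm (by omega)
      rcases h with h | h
      · exact ⟨z - 1, by push_cast; linarith⟩
      · exact ⟨z + 1, by push_cast; linarith⟩

end SpectralFamily

/-- An integer sequence of length `n` that satisfies the conditions that characterize the content
vectors of standard tableaux. -/
structure IsContentSeq (n : ℕ) (v : ℕ → ℤ) : Prop where
  zero : 0 < n → v 0 = 0
  neighbour : ∀ q, 0 < q → q < n → ∃ m < q, v m = v q + 1 ∨ v m = v q - 1
  above : ∀ p q, p < q → q < n → v p = v q → ∃ m, p < m ∧ m < q ∧ v m = v p + 1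
  below : ∀ p q, p < q → q < n → v p = v q → ∃ m, p < m ∧ m < q ∧ v m = v p - 1

theorem SpectralFamily.isContentSeq {n : ℕ} {C : Set (ℕ → ℝ)} (hC : SpectralFamily n C)
    {a : ℕ → ℝ} (ha : a ∈ C) : ∃ v : ℕ → ℤ, IsContentSeq n v ∧ ∀ k < n, a k = v k := by
  choose! v hv using fun q hq => hC.exists_int ha q hq
  refine ⟨v, ⟨?_, ?_, ?_, ?_⟩, hv⟩
  · intro h
    have := hC.zero a ha h
    rw [hv 0 h] at this; exact_mod_cast this
  · intro q h0 hq
    obtain ⟨m, hm, h⟩ := hC.exists_neighbour_lt q a ha h0 hq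
    rw [hv q hq, hv m (by omega)] at h
    exact ⟨m, hm, by exact_mod_cast h⟩
  all_goals
    intro p q hpq hq he
    obtain ⟨⟨m, h1, h2, h3⟩, ⟨m', h1', h2', h3'⟩⟩ := hC.exists_between (q - p) a ha p q hpq hq
      le_rfl (by rw [hv p (by omega), hv q hq, he])
    rw [hv p (by omega), hv _ (by omega)] at h3 h3'
  · exact ⟨m, h1, h2, by exact_mod_cast h3⟩
  · exact ⟨m', h1', h2', by exact_mod_cast h3'⟩

/-! ### Standard tableaux are determined by their contents. -/

namespace Tableau

variable {n : ℕ}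

theorem cell_mem (t : Tableau n) (k : Fin n) : t.cell k ∈ t.shape.cells := (t.entry.symm k).2

theorem entry_cell (t : Tableau n) (k : Fin n) : t.entry ⟨t.cell k, t.cell_mem k⟩ = k :=
  t.entry.apply_symm_apply k

theorem cell_entry (t : Tableau n) (x : {x // x ∈ t.shape.cells}) : t.cell (t.entry x) = x.1 := by
  rw [cell, Equiv.symm_apply_apply]

theorem exists_cell_eq (t : Tableau n) {x : ℕ × ℕ} (hx : x ∈ t.shape) : ∃ k, t.cell k = x :=
  ⟨t.entry ⟨x, hx⟩, t.cell_entry _⟩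

theorem cell_inj (t : Tableau n) {k l : Fin n} (h : t.cell k = t.cell l) : k = l :=
  t.entry.symm.injective (Subtype.ext h)

theorem isStandard_iff (t : Tableau n) : t.IsStandard ↔ ∀ k l : Fin n,
    (t.cell l = ((t.cell k).1, (t.cell k).2 + 1) ∨ t.cell l = ((t.cell k).1 + 1, (t.cell k).2)) →
      k ≤ l := by
  constructor
  · intro h k l hkl
    simpa [entry_cell] using h ⟨t.cell k, t.cell_mem k⟩ ⟨t.cell l, t.cell_mem l⟩ hkl
  · intro h x y hxy
    exact h _ _ (by simpa only [cell_entry] using hxy)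

theorem IsStandard.le_of_cell_le {t : Tableau n} (ht : t.IsStandard) {k l : Fin n}
    (h : t.cell k ≤ t.cell l) : k ≤ l := by
  rw [isStandard_iff] at ht
  obtain ⟨d, hd⟩ : ∃ d, d = ((t.cell l).1 - (t.cell k).1) + ((t.cell l).2 - (t.cell k).2) :=
    ⟨_, rfl⟩
  obtain ⟨h1, h2⟩ := Prod.le_def.1 h
  induction d generalizing l with
  | zero =>
    exact (t.cell_inj (Prod.ext (by omega) (by omega))).le
  | succ d ih =>
    by_cases h3 : (t.cell k).1 < (t.cell l).1
    · obtain ⟨m, hm⟩ := t.exists_cell_eq (x := ((t.cell l).1 - 1, (t.cell l).2))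
        (t.shape.up_left_mem (Nat.sub_le _ _) le_rfl (t.cell_mem l))
      have hm1 := congrArg Prod.fst hm
      have hm2 := congrArg Prod.snd hm
      dsimp only at hm1 hm2
      refine (ih (Prod.le_def.2 ⟨by omega, by omega⟩) (by omega) (by omega) (by omega)).trans
        (ht m l (Or.inr ?_))
      ext <;> dsimp only <;> omega
    · obtain ⟨m, hm⟩ := t.exists_cell_eq (x := ((t.cell l).1, (t.cell l).2 - 1))
        (t.shape.up_left_mem le_rfl (Nat.sub_le _ _) (t.cell_mem l))
      have hm1 := congrArg Prod.fst hm
      have hm2 := congrArg Prod.snd hm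
      dsimp only at hm1 hm2
      refine (ih (Prod.le_def.2 ⟨by omega, by omega⟩) (by omega) (by omega) (by omega)).trans
        (ht m l (Or.inl ?_))
      ext <;> dsimp only <;> omega

/-- If `k` stood higher on its diagonal in `s`, its cell would lie in the shape of `t` and hold
there a letter at most `k`. An earlier letter already occupies the same cell in `s`, and `k` itself
is excluded by the strict inequality. -/
theorem not_cell_fst_lt_of_content_eq {s t : Tableau n} (ht : t.IsStandard)
    {k : Fin n} (hk : s.content k = t.content k) (h : ∀ l < k, s.cell l = t.cell l) :
    ¬ (s.cell k).1 < (t.cell k).1 := by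
  intro hlt
  unfold content at hk
  have hle : s.cell k ≤ t.cell k := Prod.le_def.2 ⟨by omega, by omega⟩
  obtain ⟨l, hl⟩ := t.exists_cell_eq
    (x := s.cell k) (t.shape.up_left_mem hle.1 hle.2 (t.cell_mem k))
  have hlk : l ≤ k := ht.le_of_cell_le (hl ▸ hle)
  rcases hlk.lt_or_eq with h1 | rfl
  · rw [← h l h1] at hl
    exact h1.ne (s.cell_inj hl)
  · rw [hl] at hlt; exact lt_irrefl _ hlt

theorem eq_of_content_eq {s t : Tableau n} (hs : s.IsStandard) (ht : t.IsStandard)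
    (h : s.content = t.content) : s = t := by
  apply cell_injective
  funext k
  induction k using WellFoundedLT.induction with
  | _ k ih =>
    have h1 := not_cell_fst_lt_of_content_eq ht (congrFun h k) ih
    have h2 := not_cell_fst_lt_of_content_eq hs (congrFun h k).symm fun l hl => (ih l hl).symm
    have hk := congrFun h k
    unfold content at hk
    ext <;> omega

theorem content_mem_Ioo (t : Tableau n) (k : Fin n) :
    t.content k ∈ Finset.Ioo (-(n : ℤ)) n := by
  have := t.cell_lt k
  simp only [content, Finset.mem_Ioo]
  omega

end Tableau

/-! ### Every content sequence comes from a standard tableau. -/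

section Count

theorem exists_count_eq {P : ℕ → Prop} [DecidablePred P] {d k : ℕ} (h : d < Nat.count P k) :
    ∃ l < k, P l ∧ Nat.count P l = d := by
  induction k with
  | zero => simp at h
  | succ k ih =>
    by_cases hd : d < Nat.count P k
    · obtain ⟨l, hl, h'⟩ := ih hd
      exact ⟨l, by omega, h'⟩
    · rw [Nat.count_succ] at h
      by_cases hP : P k
      · simp only [hP, if_true] at h
        exact ⟨k, by omega, hP, by omega⟩
      · simp only [hP, if_false] at h; omega

theorem count_lt_count {P : ℕ → Prop} [DecidablePred P] {p m q : ℕ} (hpm : p ≤ m) (hmq : m < q)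
    (h : P m) : Nat.count P p < Nat.count P q := by
  have h1 := Nat.count_monotone P hpm
  have h2 := Nat.count_monotone P (Nat.succ_le_of_lt hmq)
  rw [Nat.count_succ, if_pos h] at h2
  omega

/-- Occurrences of `a` are separated by occurrences of `b`, so the count of `b` keeps pace with that
of `a`; `δ` is the head start of `b` before the first `a`. -/
theorem count_add_le_count {n : ℕ} {v : ℕ → ℤ} {a b : ℤ} {δ : ℕ}
    (hb : ∀ p q, p < q → q < n → v p = a → v q = a → ∃ m, p < m ∧ m < q ∧ v m = b)
    (h0 : ∀ q < n, v q = a → δ ≤ Nat.count (fun j => v j = b) q)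
    (q : ℕ) (hq : q < n) (hv : v q = a) :
    Nat.count (fun j => v j = a) q + δ ≤ Nat.count (fun j => v j = b) q := by
  induction q using Nat.strong_induction_on with
  | _ q ih =>
    rcases Nat.eq_zero_or_pos (Nat.count (fun j => v j = a) q) with h | h
    · rw [h, zero_add]; exact h0 q hq hv
    · obtain ⟨p, hp, hpa, hc⟩ := exists_count_eq (P := fun j => v j = a) (k := q)
        (d := Nat.count (fun j => v j = a) q - 1) (by omega)
      have := ih p hp (by omega) hpa
      obtain ⟨m, h1, h2, h3⟩ := hb p q hp hq hpa hv
      have := count_lt_count (P := fun j => v j = b) h1.le h2 h3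
      omega

end Count

namespace IsContentSeq

variable {n : ℕ} {v : ℕ → ℤ}

protected theorem neg (hv : IsContentSeq n v) : IsContentSeq n (fun k => - v k) where
  zero h := by simp [hv.zero h]
  neighbour q h0 hq := by
    obtain ⟨m, hm, h⟩ := hv.neighbour q h0 hq
    exact ⟨m, hm, by omega⟩
  above p q hpq hq he := by
    obtain ⟨m, h1, h2, h3⟩ := hv.below p q hpq hq (by omega)
    exact ⟨m, h1, h2, by omega⟩
  below p q hpq hq he := by
    obtain ⟨m, h1, h2, h3⟩ := hv.above p q hpq hq (by omega)
    exact ⟨m, h1, h2, by omega⟩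

/-- If the earlier neighbour is `v q - 1`, two applications of the induction hypothesis climb from
it to `v q` and then to `v q + 1`, each time at an earlier position. -/
theorem exists_succ_of_neg (hv : IsContentSeq n v) (q : ℕ) (hq : q < n) (h : v q < 0) :
    ∃ m < q, v m = v q + 1 := by
  induction q using Nat.strong_induction_on with
  | _ q ih =>
    rcases Nat.eq_zero_or_pos q with rfl | h0
    · have := hv.zero hq; omega
    · obtain ⟨m, hm, h1 | h1⟩ := hv.neighbour q h0 hq
      · exact ⟨m, hm, h1⟩
      · obtain ⟨m', hm', h2⟩ := ih m hm (by omega) (by omega)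
        obtain ⟨m'', hm'', h3⟩ := ih m' (by omega) (by omega) (by omega)
        exact ⟨m'', by omega, by omega⟩

end IsContentSeq

/-- The cell of the letter `q` in the tableau with contents `v`: its position on the diagonal is the
number of earlier letters on this diagonal. -/
def cellOf (v : ℕ → ℤ) (q : ℕ) : ℕ × ℕ :=
  (Nat.count (fun j => v j = v q) q + (-v q).toNat, Nat.count (fun j => v j = v q) q + (v q).toNat)

theorem cellOf_neg (v : ℕ → ℤ) (q : ℕ) : cellOf (fun k => - v k) q = (cellOf v q).swap := by
  simp [cellOf]

theorem cellOf_injective (v : ℕ → ℤ) : Function.Injective (cellOf v) := by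
  intro p q h
  simp only [cellOf, Prod.mk.injEq] at h
  have e : v p = v q := by omega
  rcases lt_trichotomy p q with hlt | rfl | hlt
  · have := count_lt_count (P := fun j => v j = v q) le_rfl hlt e
    rw [e] at h; omega
  · rfl
  · have := count_lt_count (P := fun j => v j = v q) le_rfl hlt rfl
    rw [e] at h; omega

namespace IsContentSeq

variable {n : ℕ} {v : ℕ → ℤ}

theorem exists_cellOf_up (hv : IsContentSeq n v) {q : ℕ} (hq : q < n) (h : 0 < (cellOf v q).1) :
    ∃ l < q, cellOf v l = ((cellOf v q).1 - 1, (cellOf v q).2) := by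
  have hb : ∀ p r, p < r → r < n → v p = v q → v r = v q →
      ∃ m, p < m ∧ m < r ∧ v m = v q + 1 := fun p r hpr hr h1 h2 => by
    obtain ⟨m, h3, h4, h5⟩ := hv.above p r hpr hr (by omega)
    exact ⟨m, h3, h4, by omega⟩
  simp only [cellOf] at h ⊢
  rcases lt_or_ge (v q) 0 with h0 | h0
  -- Below the main diagonal, the cell above has the same index on the next diagonal, so one more
  -- occurrence of `v q + 1` is needed; on or right of the main diagonal its index is smaller by one
  -- and `δ = 0` suffices.
  · have := count_add_le_count (δ := 1) hb (fun r hr he => by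
      obtain ⟨m, hm, h1⟩ := hv.exists_succ_of_neg r hr (by omega)
      have := count_lt_count (P := fun j => v j = v q + 1) (Nat.zero_le m) hm (by omega)
      omega) q hq rfl
    obtain ⟨l, hl, h1, h2⟩ := exists_count_eq (Nat.lt_of_succ_le this)
    refine ⟨l, hl, ?_⟩
    rw [h1, h2]
    ext <;> dsimp only <;> omega
  · have := count_add_le_count (δ := 0) hb (fun _ _ _ => Nat.zero_le _) q hq rfl
    obtain ⟨l, hl, h1, h2⟩ := exists_count_eq (P := fun j => v j = v q + 1)
      (d := Nat.count (fun j => v j = v q) q - 1) (k := q) (by omega)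
    refine ⟨l, hl, ?_⟩
    rw [h1, h2]
    ext <;> dsimp only <;> omega

/-- Negating all contents transposes the diagram. -/
theorem exists_cellOf_left (hv : IsContentSeq n v) {q : ℕ} (hq : q < n)
    (h : 0 < (cellOf v q).2) : ∃ l < q, cellOf v l = ((cellOf v q).1, (cellOf v q).2 - 1) := by
  obtain ⟨l, hl, h1⟩ := hv.neg.exists_cellOf_up hq (by simpa [cellOf_neg] using h)
  refine ⟨l, hl, ?_⟩
  simpa [cellOf_neg, Prod.ext_iff, and_comm] using h1

theorem exists_cellOf_le (hv : IsContentSeq n v) (q : ℕ) (hq : q < n) (x : ℕ × ℕ)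
    (hx : x ≤ cellOf v q) : ∃ l ≤ q, cellOf v l = x := by
  induction q using Nat.strong_induction_on with
  | _ q ih =>
    obtain ⟨h1, h2⟩ := Prod.le_def.1 hx
    by_cases h3 : x.1 < (cellOf v q).1
    · obtain ⟨l, hl, e⟩ := hv.exists_cellOf_up hq (by omega)
      obtain ⟨m, hm, e'⟩ := ih l hl (by omega) (by rw [e]; exact ⟨by dsimp only; omega, h2⟩)
      exact ⟨m, by omega, e'⟩
    by_cases h4 : x.2 < (cellOf v q).2
    · obtain ⟨l, hl, e⟩ := hv.exists_cellOf_left hq (by omega)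
      obtain ⟨m, hm, e'⟩ := ih l hl (by omega) (by rw [e]; exact ⟨h1, by dsimp only; omega⟩)
      exact ⟨m, by omega, e'⟩
    · exact ⟨q, le_rfl, Prod.ext (by omega) (by omega)⟩

/-- A content sequence is the sequence of contents of a standard tableau. -/
theorem exists_tableau (hv : IsContentSeq n v) :
    ∃ t : Tableau n, t.IsStandard ∧ ∀ k : Fin n, t.content k = v k := by
  let μ : YoungDiagram := ⟨Finset.univ.image fun k : Fin n => cellOf v k, by
    intro y x hxy hy
    obtain ⟨q, rfl⟩ : ∃ q : Fin n, cellOf v q = y := by simpa using hy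
    obtain ⟨l, hl, e⟩ := hv.exists_cellOf_le q q.2 x hxy
    simpa using ⟨⟨l, by omega⟩, e⟩⟩
  let f : Fin n → {x // x ∈ μ.cells} := fun k =>
    ⟨cellOf v k, Finset.mem_image_of_mem _ (Finset.mem_univ k)⟩
  have hf : Function.Bijective f := by
    constructor
    · intro k l h
      exact Fin.ext (cellOf_injective v (congrArg Subtype.val h))
    · rintro ⟨x, hx⟩
      obtain ⟨q, rfl⟩ : ∃ q : Fin n, cellOf v q = x := by simpa [μ] using hx
      exact ⟨q, rfl⟩
  let t : Tableau n := ⟨μ, (Equiv.ofBijective f hf).symm⟩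
  have hc : ∀ k, t.cell k = cellOf v k := fun k => rfl
  refine ⟨t, t.isStandard_iff.2 ?_, ?_⟩
  · intro k l h
    rw [hc, hc] at h
    have hle : cellOf v k ≤ cellOf v l := by
      rcases h with h | h <;> rw [h] <;> exact ⟨by simp, by simp⟩
    obtain ⟨m, hm, e⟩ := hv.exists_cellOf_le l l.2 _ hle
    have := cellOf_injective v e
    exact Fin.le_def.2 (by omega)
  · intro k
    rw [Tableau.content, hc]
    simp only [cellOf]
    omega

end IsContentSeq

/-! ### Local analysis of `X = L_{k-1}`, `Y = L_k`, `S = σ_k` on a joint eigenvector. -/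

section Operators

open scoped InnerProductSpace

variable {E : Type*} [NormedAddCommGroup E] [InnerProductSpace ℝ E] {X Y S : E →ₗ[ℝ] E} {v : E}
  {c d ε : ℝ}

theorem eigenvalue_ne_of_symmetric (hX : X.IsSymmetric) (hXS : ∀ u, X (S u) = S (Y u) - u)
    (hv : v ≠ 0) (h1 : X v = c • v) (h2 : Y v = d • v) : d ≠ c := by
  rintro rfl
  have h := hX (S v) v
  rw [hXS, h2, h1, map_smul, inner_sub_left, inner_smul_left, inner_smul_right] at h
  have : ⟪v, v⟫_ℝ = 0 := by simpa using h
  exact hv (inner_self_eq_zero.1 this)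

theorem swapped_eigenvector (hXS : ∀ u, X (S u) = S (Y u) - u) (hYS : ∀ u, Y (S u) = S (X u) + u)
    (h1 : X v = c • v) (h2 : Y v = d • v) :
    X ((d - c) • S v - v) = d • ((d - c) • S v - v) ∧
      Y ((d - c) • S v - v) = c • ((d - c) • S v - v) := by
  constructor
  · rw [map_sub, map_smul, hXS, h1, h2, map_smul]; module
  · rw [map_sub, map_smul, hYS, h1, h2, map_smul]; module

theorem swapped_eigenvector_ne_zero (hSS : ∀ u, S (S u) = u) (hv : v ≠ 0) (h1 : d ≠ c + 1)
    (h2 : d ≠ c - 1) : (d - c) • S v - v ≠ 0 := by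
  intro h
  have e1 : (d - c) • S v = v := sub_eq_zero.1 h
  have e2 : (d - c) • v = S v := by
    conv_rhs => rw [← e1]
    rw [map_smul, hSS]
  have e3 : ((d - c) ^ 2 - 1) • v = 0 := by
    rw [sub_smul, one_smul, pow_two, mul_smul, e2, e1, sub_self]
  rcases smul_eq_zero.1 e3 with h | h
  · have : (d - (c + 1)) * (d - (c - 1)) = 0 := by linear_combination h
    rcases mul_eq_zero.1 this with h | h
    · exact h1 (sub_eq_zero.1 h)
    · exact h2 (sub_eq_zero.1 h)
  · exact hv h

/-- The defect `w = S v - ε v` has `X`-eigenvalue `c + ε`, hence is orthogonal to `v`; since it is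
also an eigenvector of the symmetric `S`, it is orthogonal to `S v`, and so to itself. -/
theorem apply_eq_smul_of_neighbour (hX : X.IsSymmetric) (hS : S.IsSymmetric)
    (hXS : ∀ u, X (S u) = S (Y u) - u) (hSS : ∀ u, S (S u) = u) (hε : ε = 1 ∨ ε = -1)
    (h1 : X v = c • v) (h2 : Y v = (c + ε) • v) : S v = ε • v := by
  have hε2 : ε * ε = 1 := by rcases hε with rfl | rfl <;> norm_num
  have hε0 : ε ≠ 0 := by rintro rfl; norm_num at hε2
  set w := S v - ε • v with hw
  have hXw : X w = (c + ε) • w := by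
    rw [hw, map_sub, map_smul, hXS, h1, h2, map_smul]
    linear_combination (norm := module) hε2 • v
  have hSw : S w = -ε • w := by
    rw [hw, map_sub, map_smul, hSS]
    linear_combination (norm := module) -hε2 • v
  have hwv : ⟪w, v⟫_ℝ = 0 := by
    have h := hX w v
    rw [hXw, h1, inner_smul_left, inner_smul_right] at h
    simp only [conj_trivial] at h
    have : ε * ⟪w, v⟫_ℝ = 0 := by linarith
    exact (mul_eq_zero.1 this).resolve_left hε0
  have hww : ⟪w, w⟫_ℝ = 0 := by
    have h := hS w v
    rw [hSw, inner_smul_left, hwv, mul_zero] at h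
    conv_lhs => rw [hw]
    rw [inner_sub_left, real_inner_comm, ← h, inner_smul_left, real_inner_comm, hwv]
    simp
  exact sub_eq_zero.1 (inner_self_eq_zero.1 hww)

end Operators

/-! ### The regular representation and the joint spectrum of the Jucys–Murphy elements. -/

section Representation

variable {n : ℕ}

instance : Fintype (SymGrp n) := Fintype.ofEquiv _ MulOpposite.opEquiv

/-- The regular representation on the Euclidean space with the group as orthonormal basis. -/
noncomputable def regularRep (n : ℕ) :
    SymGrp n →* Module.End ℝ (EuclideanSpace ℝ (SymGrp n)) where
  toFun g := (LinearIsometryEquiv.piLpCongrLeft 2 ℝ ℝ (Equiv.mulLeft g)).toLinearEquiv.toLinearMap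
  map_one' := by
    ext v x
    simp only [Equiv.mulLeft_one]
    rfl
  map_mul' g h := by
    ext v x
    simp [LinearIsometryEquiv.piLpCongrLeft_apply, Equiv.Perm.mul_def]

theorem regularRep_apply (g x : SymGrp n) (v : EuclideanSpace ℝ (SymGrp n)) :
    regularRep n g v x = v (g⁻¹ * x) := by
  simp [regularRep, LinearIsometryEquiv.piLpCongrLeft_apply]

/-- An involution permutes the orthonormal basis and equals its own inverse. This makes
transpositions, and so the Jucys–Murphy elements, symmetric. -/
theorem regularRep_isSymmetric (g : SymGrp n) (hg : g * g = 1) :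
    (regularRep n g).IsSymmetric := by
  intro v w
  simp only [PiLp.inner_apply, regularRep_apply]
  refine Fintype.sum_equiv (Equiv.mulLeft g) _ _ fun x => ?_
  rw [inv_eq_of_mul_eq_one_left hg, Equiv.coe_mulLeft, ← mul_assoc, hg, one_mul]

/-- The rational group algebra acting on the Euclidean space of the regular representation. -/
noncomputable def regularHom (n : ℕ) :
    MonoidAlgebra ℚ (SymGrp n) →ₐ[ℚ] Module.End ℝ (EuclideanSpace ℝ (SymGrp n)) :=
  MonoidAlgebra.lift ℚ _ _ (regularRep n)

theorem regularHom_single (g : SymGrp n) :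
    regularHom n (MonoidAlgebra.single g 1) = regularRep n g := by
  simp [regularHom]

theorem regularHom_apply_single_one (x : MonoidAlgebra ℚ (SymGrp n)) (g : SymGrp n) :
    regularHom n x (EuclideanSpace.single 1 1) g = (x.coeff g : ℝ) := by
  induction x using MonoidAlgebra.induction_linear with
  | zero => simp
  | add x y hx hy => simp [hx, hy]
  | single h r =>
    simp only [regularHom, MonoidAlgebra.lift_single, LinearMap.smul_apply, PiLp.smul_apply,
      regularRep_apply, MonoidAlgebra.coeff_single, Finsupp.single_apply]
    by_cases e : h = g
    · simp [e, Rat.smul_def]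
    · have : ¬ h⁻¹ * g = 1 := fun h' => e (inv_mul_eq_one.1 h')
      simp [e, this]

theorem regularHom_injective : Function.Injective (regularHom n) := by
  intro x y h
  ext g
  have := regularHom_apply_single_one x g
  rw [h, regularHom_apply_single_one] at this
  exact (Rat.cast_injective this).symm

theorem swap_op_mul_self (i k : Fin n) :
    (MulOpposite.op (Equiv.swap i k) : SymGrp n) * MulOpposite.op (Equiv.swap i k) = 1 := by
  rw [← MulOpposite.op_mul, Equiv.swap_mul_self, MulOpposite.op_one]

theorem regularHom_simpleElt_isSymmetric (i : Fin (n - 1)) :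
    (regularHom n (simpleElt ℚ i)).IsSymmetric := by
  rw [simpleElt, regularHom_single]
  exact regularRep_isSymmetric _ (swap_op_mul_self _ _)

theorem regularHom_jucysMurphy_isSymmetric (k : Fin n) :
    (regularHom n (jucysMurphy ℚ k)).IsSymmetric := by
  rw [jucysMurphy, map_sum]
  refine Finset.sum_induction _ LinearMap.IsSymmetric (fun _ _ => LinearMap.IsSymmetric.add)
    (fun _ _ => by simp) fun i _ => ?_
  rw [regularHom_single]
  exact regularRep_isSymmetric _ (swap_op_mul_self _ _)

/-- The joint spectrum of the Jucys-Murphy elements, as a set of sequences. -/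
def jointSpectrum (n : ℕ) : Set (ℕ → ℝ) :=
  {a | ∃ v : EuclideanSpace ℝ (SymGrp n), v ≠ 0 ∧
    ∀ k : Fin n, regularHom n (jucysMurphy ℚ k) v = a k • v}

theorem regularHom_lo_apply (i : Fin (n - 1)) (u : EuclideanSpace ℝ (SymGrp n)) :
    regularHom n (jucysMurphy ℚ (lo i)) (regularHom n (simpleElt ℚ i) u) =
      regularHom n (simpleElt ℚ i) (regularHom n (jucysMurphy ℚ (hi i)) u) - u := by
  have h := congrArg (fun x => regularHom n x u) (simpleElt_mul_jucysMurphy_hi (K := ℚ) i)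
  simp only [map_add, map_mul, map_one, LinearMap.add_apply, Module.End.mul_apply,
    Module.End.one_apply] at h
  rw [h, add_sub_cancel_right]

theorem regularHom_hi_apply (i : Fin (n - 1)) (u : EuclideanSpace ℝ (SymGrp n)) :
    regularHom n (jucysMurphy ℚ (hi i)) (regularHom n (simpleElt ℚ i) u) =
      regularHom n (simpleElt ℚ i) (regularHom n (jucysMurphy ℚ (lo i)) u) + u := by
  have h := congrArg (fun x => regularHom n x u) (simpleElt_mul_jucysMurphy_lo (K := ℚ) i)
  simp only [map_sub, map_mul, map_one, LinearMap.sub_apply, Module.End.mul_apply,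
    Module.End.one_apply] at h
  rw [h, sub_add_cancel]

theorem regularHom_simpleElt_apply_apply (i : Fin (n - 1)) (u : EuclideanSpace ℝ (SymGrp n)) :
    regularHom n (simpleElt ℚ i) (regularHom n (simpleElt ℚ i) u) = u := by
  rw [← Module.End.mul_apply, ← map_mul, simpleElt_mul_self, map_one, Module.End.one_apply]

theorem spectralFamily_jointSpectrum (n : ℕ) : SpectralFamily n (jointSpectrum n) where
  zero := by
    rintro a ⟨v, hv, h⟩ hn
    have := h ⟨0, hn⟩
    rw [jucysMurphy_zero _ rfl, map_zero, LinearMap.zero_apply] at this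
    exact (smul_eq_zero.1 this.symm).resolve_right hv
  ne := by
    rintro a ⟨v, hv, h⟩ i hi
    let j : Fin (n - 1) := ⟨i, by omega⟩
    exact eigenvalue_ne_of_symmetric (regularHom_jucysMurphy_isSymmetric _)
      (regularHom_lo_apply j) hv (h (lo j)) (h (ModularMurphy.hi j))
  swap := by
    rintro a ⟨v, hv, h⟩ i hin h1 h2
    let j : Fin (n - 1) := ⟨i, by omega⟩
    obtain ⟨e1, e2⟩ := swapped_eigenvector (regularHom_lo_apply j) (regularHom_hi_apply j)
      (h (lo j)) (h (hi j))
    refine ⟨_, swapped_eigenvector_ne_zero (regularHom_simpleElt_apply_apply j) hv h1 h2, ?_⟩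
    intro k
    by_cases k1 : k = lo j
    · subst k1
      rw [Function.comp_apply, show ((lo j : Fin n) : ℕ) = i from rfl, Equiv.swap_apply_left]
      exact e1
    by_cases k2 : k = hi j
    · subst k2
      rw [Function.comp_apply, show ((hi j : Fin n) : ℕ) = i + 1 from rfl, Equiv.swap_apply_right]
      exact e2
    · have k1' : (k : ℕ) ≠ i := fun e => k1 (Fin.ext e)
      have k2' : (k : ℕ) ≠ i + 1 := fun e => k2 (Fin.ext e)
      have hc := congrArg (fun x => regularHom n x v)
        (simpleElt_commute_jucysMurphy (K := ℚ) j k k1 k2).eq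
      simp only [map_mul, Module.End.mul_apply] at hc
      rw [Function.comp_apply, Equiv.swap_apply_of_ne_of_ne k1' k2', map_sub, map_smul, ← hc, h,
        map_smul]
      module
  braid := by
    rintro a ⟨v, hv, h⟩ i hin h1 h2
    let j : Fin (n - 1) := ⟨i, by omega⟩
    let l : Fin (n - 1) := ⟨i + 1, by omega⟩
    obtain ⟨ε, hε, h1⟩ : ∃ ε : ℝ, (ε = 1 ∨ ε = -1) ∧ a (i + 1) = a i + ε := by
      rcases h1 with h1 | h1
      · exact ⟨1, Or.inl rfl, h1⟩
      · exact ⟨-1, Or.inr rfl, by linarith⟩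
    have hj : regularHom n (simpleElt ℚ j) v = ε • v :=
      apply_eq_smul_of_neighbour (regularHom_jucysMurphy_isSymmetric _)
        (regularHom_simpleElt_isSymmetric j) (regularHom_lo_apply j)
        (regularHom_simpleElt_apply_apply j) hε (h (lo j)) (by rw [h (hi j)]; exact congrArg (· • v) h1)
    have hl : regularHom n (simpleElt ℚ l) v = (-ε) • v :=
      apply_eq_smul_of_neighbour (regularHom_jucysMurphy_isSymmetric _)
        (regularHom_simpleElt_isSymmetric l) (regularHom_lo_apply l)
        (regularHom_simpleElt_apply_apply l) (by rcases hε with rfl | rfl <;> simp) (h (lo l))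
        (by
          rw [h (hi l), show ((lo l : Fin n) : ℕ) = i + 1 from rfl,
            show ((hi l : Fin n) : ℕ) = i + 2 from rfl, h1, h2]
          congr 1; ring)
    -- The two transpositions act on `v` by `ε` and `-ε`, so the braid relation would give `-ε = ε`.
    have hb := congrArg (fun x => regularHom n x v) (simpleElt_braid (K := ℚ) j l rfl)
    simp only [map_mul, Module.End.mul_apply, hj, hl, map_smul, smul_smul] at hb
    rw [← sub_eq_zero, ← sub_smul] at hb
    rcases smul_eq_zero.1 hb with hb | hb
    · rcases hε with rfl | rfl <;> norm_num at hb
    · exact hv hb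

theorem exists_tableau_of_eigenvector {v : EuclideanSpace ℝ (SymGrp n)} (hv : v ≠ 0)
    {χ : Fin n → ℝ} (h : ∀ k, regularHom n (jucysMurphy ℚ k) v = χ k • v) :
    ∃ t : Tableau n, t.IsStandard ∧ ∀ k, χ k = t.content k := by
  -- The padding by 0 is harmless: the conditions used concern only positions below `n`.
  let a : ℕ → ℝ := fun k => if hk : k < n then χ ⟨k, hk⟩ else 0
  have ha : ∀ k : Fin n, a k = χ k := fun k => by simp [a]
  obtain ⟨s, hs, hs'⟩ := (spectralFamily_jointSpectrum n).isContentSeq (a := a)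
    ⟨v, hv, fun k => by rw [ha, h]⟩
  obtain ⟨t, ht, ht'⟩ := hs.exists_tableau
  exact ⟨t, ht, fun k => by rw [← ha, hs' k k.2, ht']⟩

/-- An element of the rational group algebra vanishes if it kills all joint eigenvectors of the
Jucys-Murphy elements whose eigenvalues are the contents of a standard tableau. -/
theorem eq_zero_of_forall_eigenvector (y : MonoidAlgebra ℚ (SymGrp n))
    (hy : ∀ t : Tableau n, t.IsStandard → ∀ v : EuclideanSpace ℝ (SymGrp n),
      (∀ k, regularHom n (jucysMurphy ℚ k) v = (t.content k : ℝ) • v) → regularHom n y v = 0) :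
    y = 0 := by
  apply regularHom_injective
  rw [map_zero]
  -- Spectral theorem for a commuting symmetric family: the joint eigenspaces span, and a nonzero
  -- one belongs to a standard tableau.
  have htop := LinearMap.IsSymmetric.iSup_iInf_eq_top_of_commute (𝕜 := ℝ)
    (T := fun k : Fin n => regularHom n (jucysMurphy ℚ k)) regularHom_jucysMurphy_isSymmetric
    (fun i j _ => (commute_jucysMurphy i j).map (regularHom n))
  rw [← LinearMap.ker_eq_top, eq_top_iff, ← htop]
  refine iSup_le fun χ v hv => ?_
  simp only [Submodule.mem_iInf, Module.End.mem_eigenspace_iff] at hv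
  by_cases h0 : v = 0
  · rw [h0]; exact zero_mem _
  · obtain ⟨t, ht, h⟩ := exists_tableau_of_eigenvector h0 hv
    exact hy t ht v fun k => by rw [hv, h]

end Representation

/-! ### Products of elements that are scalars modulo a left ideal. -/

section ListProd

variable {R A : Type*} [CommRing R] [Ring A] [Algebra R A] {I : Submodule A A}

/-- `x y - r s = x (y - s) + s (x - r)`, with `s` central. With `I` the annihilator of an
eigenvector, this evaluates ordered products such as `E_t` factor by factor. -/
theorem mul_sub_algebraMap_mem {x y : A} {r s : R} (hx : x - algebraMap R A r ∈ I)
    (hy : y - algebraMap R A s ∈ I) : x * y - algebraMap R A (r * s) ∈ I := by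
  have h1 := I.smul_mem x hy
  have h2 := I.smul_mem (algebraMap R A s) hx
  have h := I.add_mem h1 h2
  rw [smul_eq_mul, smul_eq_mul, mul_sub, mul_sub, Algebra.commutes s x, sub_add_sub_cancel,
    ← map_mul, mul_comm s r] at h
  exact h

theorem list_prod_sub_algebraMap_mem (l : List A) (h : ∀ x ∈ l, ∃ r : R, x - algebraMap R A r ∈ I) :
    ∃ r : R, l.prod - algebraMap R A r ∈ I := by
  induction l with
  | nil => exact ⟨1, by simp⟩
  | cons x l ih =>
    obtain ⟨r, hr⟩ := h x (by simp)
    obtain ⟨s, hs⟩ := ih fun y hy => h y (by simp [hy])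
    exact ⟨r * s, by rw [List.prod_cons]; exact mul_sub_algebraMap_mem hr hs⟩

theorem list_prod_sub_one_mem (l : List A) (h : ∀ x ∈ l, x - 1 ∈ I) : l.prod - 1 ∈ I := by
  induction l with
  | nil => simp
  | cons x l ih =>
    have := mul_sub_algebraMap_mem (R := ℤ) (I := I) (x := x) (y := l.prod) (r := 1) (s := 1)
      (by simpa using h x (by simp)) (by simpa using ih fun y hy => h y (by simp [hy]))
    simpa using this

theorem list_prod_mem (l : List A) (h : ∀ x ∈ l, ∃ r : R, x - algebraMap R A r ∈ I) {x : A}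
    (hx : x ∈ l) (hxI : x ∈ I) : l.prod ∈ I := by
  induction l with
  | nil => simp at hx
  | cons y l ih =>
    rw [List.prod_cons]
    rcases List.mem_cons.1 hx with rfl | hx
    · obtain ⟨s, hs⟩ := list_prod_sub_algebraMap_mem l fun z hz => h z (by simp [hz])
      simpa using mul_sub_algebraMap_mem (I := I) (x := x) (r := (0 : R)) (by simpa using hxI) hs
    · exact I.smul_mem y (ih (fun z hz => h z (by simp [hz])) hx)

/-- The left ideal of the elements that act on a vector as zero. -/
def annihilatorOf {M : Type*} [AddCommGroup M] {S : Type*} [Ring S] [Module S M]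
    (Φ : A →+* Module.End S M) (v : M) : Submodule A A where
  carrier := {x | Φ x v = 0}
  add_mem' {x y} hx hy := by
    rw [Set.mem_ofPred_eq] at *
    rw [map_add, LinearMap.add_apply, hx, hy, add_zero]
  zero_mem' := by simp
  smul_mem' c x hx := by
    rw [Set.mem_ofPred_eq] at *
    rw [smul_eq_mul, map_mul, Module.End.mul_apply, hx, map_zero]

theorem mem_annihilatorOf {M : Type*} [AddCommGroup M] {S : Type*} [Ring S] [Module S M]
    {Φ : A →+* Module.End S M} {v : M} {x : A} : x ∈ annihilatorOf Φ v ↔ Φ x v = 0 := Iff.rfl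

end ListProd

/-! ### The rational idempotents `E_t` and their coupling by simple transpositions. -/

section Idempotents

variable {n : ℕ}

theorem jmFactor_sub_mem {I : Submodule (MonoidAlgebra ℚ (SymGrp n)) (MonoidAlgebra ℚ (SymGrp n))}
    {s : Tableau n} (hI : ∀ k, jucysMurphy ℚ k - algebraMap ℚ _ (s.content k : ℚ) ∈ I)
    (i : Fin n) (a c : ℚ) :
    a⁻¹ • (jucysMurphy ℚ i - algebraMap ℚ (MonoidAlgebra ℚ (SymGrp n)) c) -
      algebraMap ℚ _ (a⁻¹ * (s.content i - c)) ∈ I := by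
  have h := I.smul_mem (algebraMap ℚ (MonoidAlgebra ℚ (SymGrp n)) a⁻¹) (hI i)
  rw [smul_eq_mul, mul_sub, ← map_mul] at h
  convert h using 1
  rw [Algebra.smul_def, mul_sub, mul_sub, map_sub, ← map_mul]
  abel

theorem jmIdempotent_sub_one_mem
    {I : Submodule (MonoidAlgebra ℚ (SymGrp n)) (MonoidAlgebra ℚ (SymGrp n))}
    {t : Tableau n} (hI : ∀ k, jucysMurphy ℚ k - algebraMap ℚ _ (t.content k : ℚ) ∈ I) :
    jmIdempotent t - 1 ∈ I := by
  unfold jmIdempotent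
  refine list_prod_sub_one_mem _ fun x hx => ?_
  obtain ⟨c, -, rfl⟩ := List.mem_map.1 hx
  refine list_prod_sub_one_mem _ fun x hx => ?_
  obtain ⟨i, hi, rfl⟩ := List.mem_map.1 hx
  have hne : t.content i ≠ c := by simpa using hi
  have h := jmFactor_sub_mem hI i (t.content i - c) c
  rwa [inv_mul_cancel₀ (sub_ne_zero.2 (by exact_mod_cast hne)), map_one] at h

/-- At a letter `i` where the contents differ, the factor of `E_t` with `c = r_s(i)` is present and
acts as zero. -/
theorem jmIdempotent_mem
    {I : Submodule (MonoidAlgebra ℚ (SymGrp n)) (MonoidAlgebra ℚ (SymGrp n))}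
    {s t : Tableau n} (hI : ∀ k, jucysMurphy ℚ k - algebraMap ℚ _ (s.content k : ℚ) ∈ I)
    (hst : s.content ≠ t.content) : jmIdempotent t ∈ I := by
  obtain ⟨i, hi⟩ := Function.ne_iff.1 hst
  unfold jmIdempotent
  have h : ∀ c : ℤ, ∀ x ∈ ((List.finRange n).filter fun i => t.content i ≠ c).map fun i =>
      ((t.content i : ℚ) - (c : ℚ))⁻¹ •
        (jucysMurphy ℚ i - algebraMap ℚ (MonoidAlgebra ℚ (SymGrp n)) (c : ℚ)),
      ∃ r : ℚ, x - algebraMap ℚ _ r ∈ I := by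
    intro c x hx
    obtain ⟨i, -, rfl⟩ := List.mem_map.1 hx
    exact ⟨_, jmFactor_sub_mem hI i _ c⟩
  refine list_prod_mem (R := ℚ) _ (fun x hx => ?_)
    (List.mem_map.2 ⟨s.content i, (Finset.mem_sort _).2 (s.content_mem_Ioo i), rfl⟩) ?_
  · obtain ⟨c, -, rfl⟩ := List.mem_map.1 hx
    exact list_prod_sub_algebraMap_mem _ (h c)
  · refine list_prod_mem (R := ℚ) _ (h (s.content i))
      (List.mem_map.2 ⟨i, by simpa using hi.symm, rfl⟩) ?_
    have := jmFactor_sub_mem hI i (t.content i - s.content i) (s.content i)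
    rwa [sub_self, mul_zero, map_zero, sub_zero] at this

theorem regularHom_algebraMap_apply (r : ℚ) (v : EuclideanSpace ℝ (SymGrp n)) :
    regularHom n (algebraMap ℚ _ r) v = (r : ℝ) • v := by
  rw [AlgHom.commutes, Module.algebraMap_end_apply]
  ext g
  simp [Rat.smul_def]

theorem jucysMurphy_sub_mem_annihilatorOf {t : Tableau n} {v : EuclideanSpace ℝ (SymGrp n)}
    (hv : ∀ k, regularHom n (jucysMurphy ℚ k) v = (t.content k : ℝ) • v) (k : Fin n) :
    jucysMurphy ℚ k - algebraMap ℚ _ (t.content k : ℚ) ∈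
      annihilatorOf (regularHom n).toRingHom v := by
  rw [mem_annihilatorOf]
  change regularHom n _ v = 0
  rw [map_sub, LinearMap.sub_apply, hv, regularHom_algebraMap_apply]
  simp

theorem regularHom_jmIdempotent_self {t : Tableau n} {v : EuclideanSpace ℝ (SymGrp n)}
    (hv : ∀ k, regularHom n (jucysMurphy ℚ k) v = (t.content k : ℝ) • v) :
    regularHom n (jmIdempotent t) v = v := by
  have := mem_annihilatorOf.1 (jmIdempotent_sub_one_mem (jucysMurphy_sub_mem_annihilatorOf hv))
  simpa [sub_eq_zero] using this

theorem regularHom_jmIdempotent_of_ne {s t : Tableau n} {v : EuclideanSpace ℝ (SymGrp n)}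
    (hv : ∀ k, regularHom n (jucysMurphy ℚ k) v = (s.content k : ℝ) • v)
    (hst : s.content ≠ t.content) : regularHom n (jmIdempotent t) v = 0 :=
  mem_annihilatorOf.1 (jmIdempotent_mem (jucysMurphy_sub_mem_annihilatorOf hv) hst)

theorem jucysMurphy_mul_jmIdempotent {t : Tableau n} (ht : t.IsStandard) (k : Fin n) :
    jucysMurphy ℚ k * jmIdempotent t = algebraMap ℚ _ (t.content k : ℚ) * jmIdempotent t := by
  rw [← sub_eq_zero]
  refine eq_zero_of_forall_eigenvector _ fun s hs v hv => ?_
  simp only [map_sub, map_mul, LinearMap.sub_apply, Module.End.mul_apply]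
  by_cases h : s = t
  · subst h
    rw [regularHom_jmIdempotent_self hv, hv]
    erw [regularHom_algebraMap_apply]
    simp
  · rw [regularHom_jmIdempotent_of_ne hv fun e => h (Tableau.eq_of_content_eq hs ht e)]
    simp

theorem jmIdempotent_commute_jucysMurphy {t : Tableau n} (ht : t.IsStandard) (k : Fin n) :
    Commute (jmIdempotent t) (jucysMurphy ℚ k) := by
  rw [Commute, SemiconjBy, ← sub_eq_zero]
  refine eq_zero_of_forall_eigenvector _ fun s hs v hv => ?_
  simp only [map_sub, map_mul, LinearMap.sub_apply, Module.End.mul_apply]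
  by_cases h : s = t
  · subst h
    rw [regularHom_jmIdempotent_self hv, hv, map_smul, regularHom_jmIdempotent_self hv, sub_self]
  · have := fun e => h (Tableau.eq_of_content_eq hs ht e)
    rw [regularHom_jmIdempotent_of_ne hv this, hv, map_smul, regularHom_jmIdempotent_of_ne hv this]
    simp

theorem jucysMurphy_sub_mem_annihilatorOf_jmIdempotent {t : Tableau n} (ht : t.IsStandard)
    (k : Fin n) : jucysMurphy ℚ k - algebraMap ℚ _ (t.content k : ℚ) ∈
      annihilatorOf (Algebra.lmul ℚ (MonoidAlgebra ℚ (SymGrp n))).toRingHom (jmIdempotent t) := by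
  rw [mem_annihilatorOf]
  change (jucysMurphy ℚ k - algebraMap ℚ _ (t.content k : ℚ)) * jmIdempotent t = 0
  rw [sub_mul, jucysMurphy_mul_jmIdempotent ht, sub_self]

theorem jmIdempotent_mul_self {t : Tableau n} (ht : t.IsStandard) :
    jmIdempotent t * jmIdempotent t = jmIdempotent t := by
  have h := mem_annihilatorOf.1 (jmIdempotent_sub_one_mem
    (jucysMurphy_sub_mem_annihilatorOf_jmIdempotent ht))
  change (jmIdempotent t - 1) * jmIdempotent t = 0 at h
  rwa [sub_mul, one_mul, sub_eq_zero] at h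

theorem jmIdempotent_mul_of_ne {s t : Tableau n} (hs : s.IsStandard) (ht : t.IsStandard)
    (hst : s ≠ t) : jmIdempotent t * jmIdempotent s = 0 :=
  mem_annihilatorOf.1 (jmIdempotent_mem (jucysMurphy_sub_mem_annihilatorOf_jmIdempotent hs)
    fun e => hst (Tableau.eq_of_content_eq hs ht e))

/-- The standard tableaux with `n` boxes. -/
noncomputable def standardTableaux (n : ℕ) : Finset (Tableau n) :=
  open scoped Classical in Finset.univ.filter fun t => t.IsStandard

theorem mem_standardTableaux {t : Tableau n} : t ∈ standardTableaux n ↔ t.IsStandard := by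
  simp [standardTableaux]

theorem sum_jmIdempotent (n : ℕ) : ∑ t ∈ standardTableaux n, jmIdempotent t = 1 := by
  rw [← sub_eq_zero]
  refine eq_zero_of_forall_eigenvector _ fun s hs v hv => ?_
  rw [map_sub, map_sum, map_one, LinearMap.sub_apply, LinearMap.sum_apply,
    Finset.sum_eq_single_of_mem s (mem_standardTableaux.2 hs), regularHom_jmIdempotent_self hv,
    Module.End.one_apply, sub_self]
  intro t ht hts
  exact regularHom_jmIdempotent_of_ne hv fun e =>
    hts (Tableau.eq_of_content_eq hs (mem_standardTableaux.1 ht) e).symm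

/-- Two Murphy idempotents can be linked by a simple transposition only if the contents agree up to
this transposition. -/
theorem content_of_jmIdempotent_mul_simpleElt_mul_ne_zero {s t : Tableau n} (hs : s.IsStandard)
    (ht : t.IsStandard) (i : Fin (n - 1))
    (h : jmIdempotent s * simpleElt ℚ i * jmIdempotent t ≠ 0) :
    s.content = t.content ∨ s.content = t.content ∘ Equiv.swap (lo i) (hi i) := by
  -- An element commuting with `σ` must have equal eigenvalues on both sides of a nonzero `E_s σ
  -- E_t`. Applied to the remaining `L_k` and to the sum and product of `L_{k-1}` and `L_k`, it
  -- fixes the contents at the two letters up to order.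
  have key : ∀ (y : MonoidAlgebra ℚ (SymGrp n)) (a b : ℤ), Commute (simpleElt ℚ i) y →
      jmIdempotent s * y = algebraMap ℚ _ (a : ℚ) * jmIdempotent s →
      y * jmIdempotent t = algebraMap ℚ _ (b : ℚ) * jmIdempotent t → a = b := by
    intro y a b hy ha hb
    have e : algebraMap ℚ _ (a : ℚ) * (jmIdempotent s * simpleElt ℚ i * jmIdempotent t) =
        algebraMap ℚ _ (b : ℚ) * (jmIdempotent s * simpleElt ℚ i * jmIdempotent t) := by
      rw [← mul_assoc, ← mul_assoc, ← ha, mul_assoc (jmIdempotent s), ← hy.eq, ← mul_assoc,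
        mul_assoc _ y, hb, ← mul_assoc, ← Algebra.commutes, mul_assoc]
    rw [← Algebra.smul_def, ← Algebra.smul_def, ← sub_eq_zero, ← sub_smul] at e
    have := (smul_eq_zero.1 e).resolve_right h
    exact_mod_cast sub_eq_zero.1 this
  have hls : ∀ k, jmIdempotent s * jucysMurphy ℚ k =
      algebraMap ℚ _ (s.content k : ℚ) * jmIdempotent s := fun k => by
    rw [(jmIdempotent_commute_jucysMurphy hs k).eq, jucysMurphy_mul_jmIdempotent hs]
  have hlt := jucysMurphy_mul_jmIdempotent ht
  have h1 : ∀ k, k ≠ lo i → k ≠ hi i → s.content k = t.content k := fun k k1 k2 =>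
    key _ _ _ (simpleElt_commute_jucysMurphy i k k1 k2) (hls k) (hlt k)
  have h2 : s.content (lo i) + s.content (hi i) = t.content (lo i) + t.content (hi i) := by
    refine key (jucysMurphy ℚ (lo i) + jucysMurphy ℚ (hi i)) _ _ ?_ ?_ ?_
    · rw [Commute, SemiconjBy, mul_add, simpleElt_mul_jucysMurphy_lo,
        simpleElt_mul_jucysMurphy_hi, add_mul]
      abel
    · rw [mul_add, hls, hls, ← add_mul, ← map_add, ← Int.cast_add]
    · rw [add_mul, hlt, hlt, ← add_mul, ← map_add, ← Int.cast_add]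
  have h3 : s.content (lo i) * s.content (hi i) = t.content (lo i) * t.content (hi i) := by
    refine key (jucysMurphy ℚ (lo i) * jucysMurphy ℚ (hi i)) _ _ ?_ ?_ ?_
    · rw [Commute, SemiconjBy, ← mul_assoc, simpleElt_mul_jucysMurphy_lo, sub_mul, mul_assoc,
        simpleElt_mul_jucysMurphy_hi, mul_add, mul_one, one_mul, add_sub_cancel_right, ← mul_assoc,
        (commute_jucysMurphy (lo i) (hi i)).eq]
    · rw [← mul_assoc, hls, mul_assoc, hls, ← mul_assoc, ← map_mul, ← Int.cast_mul]
    · rw [mul_assoc, hlt, ← mul_assoc, ← Algebra.commutes, mul_assoc, hlt, ← mul_assoc, ← map_mul,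
        ← Int.cast_mul, mul_comm]
  have h4 : (s.content (lo i) - t.content (lo i)) * (s.content (lo i) - t.content (hi i)) = 0 := by
    linear_combination s.content (lo i) * h2 - h3
  rcases mul_eq_zero.1 h4 with h5 | h5
  · left
    funext k
    by_cases k1 : k = lo i
    · rw [k1]; omega
    by_cases k2 : k = hi i
    · rw [k2]; omega
    exact h1 k k1 k2
  · right
    funext k
    rw [Function.comp_apply]
    by_cases k1 : k = lo i
    · rw [k1, Equiv.swap_apply_left]; omega
    by_cases k2 : k = hi i
    · rw [k2, Equiv.swap_apply_right]; omega
    rw [Equiv.swap_apply_of_ne_of_ne k1 k2]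
    exact h1 k k1 k2

end Idempotents

/-! ### Reduction mod `p` as a relation compatible with the ring operations. -/

section Reduction

variable {n : ℕ} (p : ℕ) [Fact p.Prime]

/-- Extension of scalars from `ℤ` for the group algebra. -/
noncomputable def ofIntegral (K : Type) [CommRing K] (n : ℕ) :
    MonoidAlgebra ℤ (SymGrp n) →+* MonoidAlgebra K (SymGrp n) :=
  MonoidAlgebra.mapRingHom (SymGrp n) (Int.castRingHom K)

theorem coeff_ofIntegral (K : Type) [CommRing K] (y : MonoidAlgebra ℤ (SymGrp n)) (g : SymGrp n) :
    (ofIntegral K n y).coeff g = (y.coeff g : K) := by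
  simp [ofIntegral]

theorem ofIntegral_single (K : Type) [CommRing K] (g : SymGrp n) (a : ℤ) :
    ofIntegral K n (MonoidAlgebra.single g a) = MonoidAlgebra.single g (a : K) := by
  simp [ofIntegral]

theorem ofIntegral_jucysMurphy (K : Type) [CommRing K] (k : Fin n) :
    ofIntegral K n (jucysMurphy ℤ k) = jucysMurphy K k := by
  simp [jucysMurphy, ofIntegral_single]

theorem ofIntegral_simpleElt (K : Type) [CommRing K] (i : Fin (n - 1)) :
    ofIntegral K n (simpleElt ℤ i) = simpleElt K i := by
  simp [simpleElt, ofIntegral_single]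

theorem ofIntegral_injective : Function.Injective (ofIntegral ℚ n) := by
  intro x y h
  ext g
  have := congrArg (fun z => z.coeff g) h
  simpa [coeff_ofIntegral] using this

/-- The element `x` of the rational group algebra has `p`-integral coefficients, with reduction
`z` mod `p`: this is witnessed by a multiple of `x` with integer coefficients. -/
def Reduces (x : MonoidAlgebra ℚ (SymGrp n)) (z : MonoidAlgebra (ZMod p) (SymGrp n)) : Prop :=
  ∃ m : ℤ, (m : ZMod p) ≠ 0 ∧ ∃ y : MonoidAlgebra ℤ (SymGrp n),
    (m : ℚ) • x = ofIntegral ℚ n y ∧ (m : ZMod p) • z = ofIntegral (ZMod p) n y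

variable {p}

theorem reduces_ofIntegral (y : MonoidAlgebra ℤ (SymGrp n)) :
    Reduces p (ofIntegral ℚ n y) (ofIntegral (ZMod p) n y) :=
  ⟨1, by simp, y, by simp, by simp⟩

theorem ofIntegral_intCast_mul (K : Type) [CommRing K] (a : ℤ) (y : MonoidAlgebra ℤ (SymGrp n)) :
    ofIntegral K n (a • y) = (a : K) • ofIntegral K n y := by
  rw [map_zsmul, Int.cast_smul_eq_zsmul]

namespace Reduces

variable {x x' : MonoidAlgebra ℚ (SymGrp n)} {z z' : MonoidAlgebra (ZMod p) (SymGrp n)}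

theorem add (h : Reduces p x z) (h' : Reduces p x' z') : Reduces p (x + x') (z + z') := by
  obtain ⟨m, hm, y, hx, hz⟩ := h
  obtain ⟨m', hm', y', hx', hz'⟩ := h'
  refine ⟨m * m', by push_cast; exact mul_ne_zero hm hm', m' • y + m • y', ?_, ?_⟩
  · rw [map_add, ofIntegral_intCast_mul, ofIntegral_intCast_mul, ← hx, ← hx']
    push_cast; module
  · rw [map_add, ofIntegral_intCast_mul, ofIntegral_intCast_mul, ← hz, ← hz']
    push_cast; module

theorem mul (h : Reduces p x z) (h' : Reduces p x' z') : Reduces p (x * x') (z * z') := by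
  obtain ⟨m, hm, y, hx, hz⟩ := h
  obtain ⟨m', hm', y', hx', hz'⟩ := h'
  refine ⟨m * m', by push_cast; exact mul_ne_zero hm hm', y * y', ?_, ?_⟩
  · rw [map_mul, ← hx, ← hx', smul_mul_smul_comm, Int.cast_mul]
  · rw [map_mul, ← hz, ← hz', smul_mul_smul_comm, Int.cast_mul]

theorem zero : Reduces p (0 : MonoidAlgebra ℚ (SymGrp n)) 0 := by
  simpa using reduces_ofIntegral (p := p) (0 : MonoidAlgebra ℤ (SymGrp n))

theorem one : Reduces p (1 : MonoidAlgebra ℚ (SymGrp n)) 1 := by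
  simpa using reduces_ofIntegral (p := p) (1 : MonoidAlgebra ℤ (SymGrp n))

theorem pow (h : Reduces p x z) (k : ℕ) : Reduces p (x ^ k) (z ^ k) := by
  induction k with
  | zero => simpa using one
  | succ k ih => rw [pow_succ, pow_succ]; exact ih.mul h

theorem sum {ι : Type*} (s : Finset ι) {f : ι → MonoidAlgebra ℚ (SymGrp n)}
    {g : ι → MonoidAlgebra (ZMod p) (SymGrp n)} (h : ∀ i ∈ s, Reduces p (f i) (g i)) :
    Reduces p (∑ i ∈ s, f i) (∑ i ∈ s, g i) := by
  classical
  induction s using Finset.induction_on with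
  | empty => simpa using zero
  | insert a s ha ih =>
    rw [Finset.sum_insert ha, Finset.sum_insert ha]
    exact (h a (Finset.mem_insert_self _ _)).add
      (ih fun i hi => h i (Finset.mem_insert_of_mem hi))

theorem intCast (a : ℤ) : Reduces p (algebraMap ℚ (MonoidAlgebra ℚ (SymGrp n)) a)
    (algebraMap (ZMod p) _ (a : ZMod p)) := by
  have := reduces_ofIntegral (p := p) (a : MonoidAlgebra ℤ (SymGrp n))
  simpa using this

theorem jucysMurphy (k : Fin n) :
    Reduces p (ModularMurphy.jucysMurphy ℚ k) (ModularMurphy.jucysMurphy (ZMod p) k) := by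
  simpa [ofIntegral_jucysMurphy] using reduces_ofIntegral (p := p) (ModularMurphy.jucysMurphy ℤ k)

theorem simpleElt (i : Fin (n - 1)) :
    Reduces p (ModularMurphy.simpleElt ℚ i) (ModularMurphy.simpleElt (ZMod p) i) := by
  simpa [ofIntegral_simpleElt] using reduces_ofIntegral (p := p) (ModularMurphy.simpleElt ℤ i)

theorem intSMul (h : Reduces p x z) (a : ℤ) : Reduces p ((a : ℚ) • x) ((a : ZMod p) • z) := by
  rw [Algebra.smul_def, Algebra.smul_def]
  exact (intCast a).mul h

theorem neg (h : Reduces p x z) : Reduces p (-x) (-z) := by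
  simpa using h.intSMul (-1)

theorem sub (h : Reduces p x z) (h' : Reduces p x' z') : Reduces p (x - x') (z - z') := by
  rw [sub_eq_add_neg, sub_eq_add_neg]
  exact h.add h'.neg

/-- This is the transfer principle: a rational identity between elements with known reductions
yields the identity of the reductions. -/
theorem unique (h : Reduces p x z) (h' : Reduces p x z') : z = z' := by
  obtain ⟨m, hm, y, hx, hz⟩ := h
  obtain ⟨m', hm', y', hx', hz'⟩ := h'
  have e : m' • y = m • y' := by
    apply ofIntegral_injective
    rw [ofIntegral_intCast_mul, ofIntegral_intCast_mul, ← hx, ← hx', smul_comm]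
  have e' := congrArg (ofIntegral (ZMod p) n) e
  rw [ofIntegral_intCast_mul, ofIntegral_intCast_mul, ← hz, ← hz', smul_smul, smul_smul,
    mul_comm] at e'
  exact smul_right_injective _ (mul_ne_zero hm hm') e'

theorem coeff_eq (h : Reduces p x z) (g : SymGrp n) :
    ¬ p ∣ (x.coeff g).den ∧ ((x.coeff g : ℚ) : ZMod p) = z.coeff g := by
  obtain ⟨m, hm, y, hx, hz⟩ := h
  have hx := congrArg (fun w => w.coeff g) hx
  have hz := congrArg (fun w => w.coeff g) hz
  simp only [MonoidAlgebra.coeff_smul_apply, coeff_ofIntegral, smul_eq_mul] at hx hz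
  set q := x.coeff g
  have e : m * q.num = y.coeff g * q.den := by
    have hq : (q.den : ℚ) ≠ 0 := by exact_mod_cast q.den_nz
    have : (m : ℚ) * q.num = y.coeff g * q.den := by
      rw [← hx, mul_assoc, Rat.mul_den_eq_num]
    exact_mod_cast this
  have e' := congrArg (Int.cast : ℤ → ZMod p) e
  push_cast at e'
  have hden : (q.den : ZMod p) ≠ 0 := by
    intro h0
    rw [h0, mul_zero] at e'
    have hnum := (mul_eq_zero.1 e').resolve_left hm
    rw [ZMod.natCast_eq_zero_iff] at h0
    rw [ZMod.intCast_zmod_eq_zero_iff_dvd] at hnum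
    have := Nat.dvd_gcd (Int.natCast_dvd.1 hnum) h0
    rw [q.reduced] at this
    exact (Fact.out : p.Prime).one_lt.ne' (Nat.dvd_one.1 this)
  refine ⟨fun h0 => hden ((ZMod.natCast_eq_zero_iff _ _).2 h0), ?_⟩
  apply mul_left_cancel₀ hm
  rw [hz, Rat.cast_def, ← mul_div_assoc, e', mul_div_cancel_right₀ _ hden]

theorem isPIntegral (h : Reduces p x z) : IsPIntegral p x := fun g => (h.coeff_eq g).1

theorem reduceMod_eq (h : Reduces p x z) : reduceMod p x = z := by
  ext g
  rw [← (h.coeff_eq g).2, reduceMod, MonoidAlgebra.coeff_sum, Finsupp.finsetSum_apply,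
    Finset.sum_eq_single g.unop]
  · simp
  · intro b _ hb
    rw [MonoidAlgebra.coeff_single, Finsupp.single_apply, if_neg]
    rintro rfl
    exact hb rfl
  · simp

end Reduces

theorem exists_natSMul_eq_ofIntegral (x : MonoidAlgebra ℚ (SymGrp n)) :
    ∃ N : ℕ, N ≠ 0 ∧ ∃ y, (N : ℚ) • x = ofIntegral ℚ n y := by
  induction x using MonoidAlgebra.induction_linear with
  | zero => exact ⟨1, one_ne_zero, 0, by simp⟩
  | add x x' h h' =>
    obtain ⟨N, hN, y, hy⟩ := h
    obtain ⟨N', hN', y', hy'⟩ := h'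
    refine ⟨N * N', mul_ne_zero hN hN', (N' : ℤ) • y + (N : ℤ) • y', ?_⟩
    rw [map_add, ofIntegral_intCast_mul, ofIntegral_intCast_mul, ← hy, ← hy']
    push_cast; module
  | single g r =>
    refine ⟨r.den, r.den_nz, MonoidAlgebra.single g r.num, ?_⟩
    rw [ofIntegral_single, MonoidAlgebra.smul_single, smul_eq_mul, Rat.den_mul_eq_num]

theorem exists_pow_smul_reduces (p : ℕ) [Fact p.Prime] (x : MonoidAlgebra ℚ (SymGrp n)) :
    ∃ M : ℕ, ∃ z, Reduces p (((p ^ M : ℕ) : ℚ) • x) z := by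
  obtain ⟨N, hN, y, hy⟩ := exists_natSMul_eq_ofIntegral x
  obtain ⟨M, m, hm, rfl⟩ := Nat.exists_eq_pow_mul_and_not_dvd hN p (Fact.out : p.Prime).ne_one
  have hm' : ((m : ℤ) : ZMod p) ≠ 0 := by
    rw [Int.cast_natCast]
    exact fun h => hm ((ZMod.natCast_eq_zero_iff _ _).1 h)
  refine ⟨M, ((m : ℤ) : ZMod p)⁻¹ • ofIntegral (ZMod p) n y, m, hm', y, ?_, ?_⟩
  · rw [← hy, smul_smul]; push_cast; rw [mul_comm]
  · rw [smul_smul, mul_inv_cancel₀ hm', one_smul]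

theorem exists_pow_smul_jmIdempotent_reduces (p : ℕ) [Fact p.Prime] (n : ℕ) :
    ∃ M : ℕ, ∀ t : Tableau n, ∃ z, Reduces p (((p ^ M : ℕ) : ℚ) • jmIdempotent t) z := by
  choose f g h using fun t : Tableau n => exists_pow_smul_reduces p (jmIdempotent t)
  -- The sum serves as a common upper bound of the finitely many exponents.
  refine ⟨∑ t, f t, fun t => ?_⟩
  obtain ⟨d, hd⟩ := Nat.exists_eq_add_of_le
    (Finset.single_le_sum (f := f) (fun _ _ => Nat.zero_le _) (Finset.mem_univ t))
  have := (h t).intSMul ((p ^ d : ℕ) : ℤ)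
  rw [hd, pow_add, mul_comm]
  rw [smul_smul] at this
  exact ⟨_, by simpa using this⟩

end Reduction

/-! ### Tableau classes and the `p`-integrality of `E_T`. -/

section Classes

variable {n : ℕ} {p : ℕ}

namespace Tableau

theorem mem_cls {s t : Tableau n} : s ∈ t.cls p ↔ s.IsStandard ∧ Equivalent p t s := by
  simp [cls]

theorem Equivalent.symm {s t : Tableau n} (h : Equivalent p s t) : Equivalent p t s :=
  fun k => (h k).symm

theorem Equivalent.trans {s t u : Tableau n} (h : Equivalent p s t) (h' : Equivalent p t u) :
    Equivalent p s u := fun k => (h k).trans (h' k)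

theorem Equivalent.refl (t : Tableau n) : Equivalent p t t := fun _ => rfl

theorem cls_eq_iff {s t : Tableau n} (ht : t.IsStandard) :
    s.cls p = t.cls p ↔ Equivalent p s t := by
  constructor
  · intro h
    have : t ∈ s.cls p := h ▸ mem_cls.2 ⟨ht, .refl t⟩
    exact (mem_cls.1 this).2
  · intro h
    ext u
    rw [mem_cls, mem_cls]
    exact and_congr_right fun _ => ⟨h.symm.trans, h.trans⟩

theorem cls_subset (t : Tableau n) : t.cls p ⊆ standardTableaux n := fun _ h =>
  mem_standardTableaux.2 (mem_cls.1 h).1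

end Tableau

open Tableau

theorem mem_tableauClasses {U : Finset (Tableau n)} :
    U ∈ tableauClasses p n ↔ ∃ u : Tableau n, u.IsStandard ∧ u.cls p = U := by
  simp [tableauClasses]

theorem classIdempotentQ_mul [DecidableEq (Tableau n)] {A B : Finset (Tableau n)}
    (hA : A ⊆ standardTableaux n) (hB : B ⊆ standardTableaux n) :
    classIdempotentQ A * classIdempotentQ B = classIdempotentQ (A ∩ B) := by
  unfold classIdempotentQ
  rw [Finset.sum_mul, ← Finset.filter_mem_eq_inter, Finset.sum_filter]
  refine Finset.sum_congr rfl fun s hs => ?_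
  have hs' := mem_standardTableaux.1 (hA hs)
  rw [Finset.mul_sum]
  split_ifs with h
  · rw [Finset.sum_eq_single_of_mem s h, jmIdempotent_mul_self hs']
    intro t ht hts
    exact jmIdempotent_mul_of_ne (mem_standardTableaux.1 (hB ht)) hs' hts
  · refine Finset.sum_eq_zero fun t ht => ?_
    exact jmIdempotent_mul_of_ne (mem_standardTableaux.1 (hB ht)) hs' (by rintro rfl; exact h ht)

theorem classIdempotentQ_commute {A : Finset (Tableau n)} (hA : A ⊆ standardTableaux n)
    (k : Fin n) : Commute (classIdempotentQ A) (jucysMurphy ℚ k) :=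
  Commute.sum_left _ _ _ fun _ ht =>
    jmIdempotent_commute_jucysMurphy (mem_standardTableaux.1 (hA ht)) k

theorem sum_classIdempotentQ (p n : ℕ) : ∑ U ∈ tableauClasses p n, classIdempotentQ U = 1 := by
  classical
  rw [← sum_jmIdempotent, tableauClasses]
  have e : standardTableaux n = Finset.univ.filter fun t : Tableau n => t.IsStandard := by
    ext; simp [mem_standardTableaux]
  rw [e]
  refine Finset.sum_image' _ fun u _ => ?_
  rw [classIdempotentQ]
  refine Finset.sum_congr ?_ fun _ _ => rfl
  ext t
  simp only [Finset.mem_filter, Finset.mem_univ, true_and, mem_cls]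
  refine and_congr_right fun _ => ?_
  constructor
  · intro h
    by_cases hu : u.IsStandard
    · exact (cls_eq_iff hu).2 h.symm
    · ext w
      rw [mem_cls, mem_cls]
      exact and_congr_right fun _ => ⟨h.trans, h.symm.trans⟩
  · intro h
    have : t ∈ u.cls p := by
      rw [← h]
      exact mem_cls.2 ⟨by assumption, .refl t⟩
    exact (mem_cls.1 this).2

theorem content_act (t : Tableau n) (i : Fin (n - 1)) (k : Fin n) :
    (t.act (simple i)).content k = t.content (Equiv.swap (lo i) (hi i) k) := by
  rfl

theorem act_act (t : Tableau n) (g h : SymGrp n) : (t.act g).act h = t.act (g * h) := rfl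

theorem act_one (t : Tableau n) : t.act 1 = t := rfl

theorem act_simple_act_simple (t : Tableau n) (i : Fin (n - 1)) :
    (t.act (simple i)).act (simple i) = t := by
  rw [act_act, simple, swap_op_mul_self, act_one]

theorem Tableau.Equivalent.act_simple {s t : Tableau n} (h : Equivalent p s t) (i : Fin (n - 1)) :
    Equivalent p (s.act (simple i)) (t.act (simple i)) := fun k => by
  rw [content_act, content_act]
  exact h _

theorem cls_mem_tableauClasses {u : Tableau n} (hu : u.IsStandard) :
    u.cls p ∈ tableauClasses p n := mem_tableauClasses.2 ⟨u, hu, rfl⟩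

variable [Fact p.Prime]

/-- A polynomial with integer coefficients in the Jucys-Murphy elements which separates a tableau
class from a given set of other standard tableaux. -/
theorem exists_separating (u : Tableau n) (Q : Finset (Tableau n))
    (hQ : ∀ s ∈ Q, ¬ Equivalent p u s) :
    ∃ (y : MonoidAlgebra ℤ (SymGrp n)) (f : Tableau n → ℤ),
      (∀ t : Tableau n, t.IsStandard →
        ofIntegral ℚ n y * jmIdempotent t = (f t : ℚ) • jmIdempotent t) ∧
      (∀ t, Equivalent p u t → (f t : ZMod p) ≠ 0) ∧ (∀ s ∈ Q, (p : ℤ) ∣ f s) := by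
  classical
  induction Q using Finset.induction_on with
  | empty => exact ⟨1, fun _ => 1, by simp, by simp, by simp⟩
  | insert s Q hs ih =>
    obtain ⟨y, f, h1, h2, h3⟩ := ih fun s hs => hQ s (Finset.mem_insert_of_mem hs)
    obtain ⟨k, hk⟩ := not_forall.1 (hQ s (Finset.mem_insert_self _ _))
    -- The new factor has eigenvalue 0 at `s`, and is nonzero mod `p` on the class of `u` because
    -- `k` distinguishes `u` from `s`.
    refine ⟨y * (jucysMurphy ℤ k - (s.content k : ℤ)), fun t => f t * (t.content k - s.content k),
      fun t ht => ?_, fun t ht => ?_, fun r hr => ?_⟩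
    · rw [map_mul, map_sub, ofIntegral_jucysMurphy, map_intCast, mul_assoc, sub_mul,
        jucysMurphy_mul_jmIdempotent ht, ← Algebra.smul_def, ← zsmul_eq_mul,
        ← Int.cast_smul_eq_zsmul ℚ, ← sub_smul, mul_smul_comm, h1 t ht, smul_smul]
      push_cast
      rw [mul_comm]
    · push_cast
      refine mul_ne_zero (h2 t ht) fun h0 => hk ?_
      rw [← Int.cast_sub, ZMod.intCast_zmod_eq_zero_iff_dvd] at h0
      exact (ht k).trans (Int.modEq_iff_dvd.2 h0).symm
    · rcases Finset.mem_insert.1 hr with rfl | hr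
      · simp
      · exact (h3 r hr).mul_right _

/-- Fermat gives `f^(p-1) ≡ 1` mod `p`, and each `p`-th power improves the congruence by a factor
`p`. In the other case the exponent is at least `M`. -/
theorem exists_pow_dvd (f : ℤ) (M : ℕ) :
    ((f : ZMod p) ≠ 0 → ((p ^ M : ℕ) : ℤ) ∣ 1 - f ^ (p ^ M * (p - 1))) ∧
      ((p : ℤ) ∣ f → ((p ^ M : ℕ) : ℤ) ∣ f ^ (p ^ M * (p - 1))) := by
  have hp : p.Prime := Fact.out
  constructor
  · intro hf
    have h : (p : ℤ) ∣ 1 - f ^ (p - 1) := by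
      rw [← ZMod.intCast_zmod_eq_zero_iff_dvd]
      push_cast
      rw [ZMod.pow_card_sub_one_eq_one hf, sub_self]
    have h' := dvd_sub_pow_of_dvd_sub h M
    rw [one_pow, ← pow_mul, mul_comm (p - 1)] at h'
    refine dvd_trans ?_ h'
    exact_mod_cast pow_dvd_pow p (Nat.le_succ M)
  · intro hf
    push_cast
    refine (pow_dvd_pow_of_dvd hf M).trans (pow_dvd_pow f ?_)
    exact (Nat.lt_pow_self hp.one_lt).le.trans
      (Nat.le_mul_of_pos_right _ (Nat.sub_pos_of_lt hp.one_lt))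

/-- Replace the eigenvalues 1 and 0 of `E_T` by those of a high power of an integral separating
polynomial. The errors are multiples of `p^M`, which absorb the denominators of the individual
`E_t`. -/
theorem exists_classIdempotentQ_reduces (u : Tableau n) :
    ∃ z, Reduces p (classIdempotentQ (u.cls p)) z := by
  classical
  obtain ⟨M, hM⟩ := exists_pow_smul_jmIdempotent_reduces p n
  obtain ⟨y, f, h1, h2, h3⟩ := exists_separating (p := p) u
    ((standardTableaux n).filter fun t => ¬ Equivalent p u t) (by simp)
  set e := p ^ M * (p - 1) with he
  have hpow : ∀ t : Tableau n, t.IsStandard → ∀ k : ℕ,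
      ofIntegral ℚ n y ^ k * jmIdempotent t = ((f t ^ k : ℤ) : ℚ) • jmIdempotent t := by
    intro t ht k
    induction k with
    | zero => simp
    | succ k ih =>
      rw [pow_succ, mul_assoc, h1 t ht, mul_smul_comm, ih, smul_smul, pow_succ]
      push_cast; rw [mul_comm]
  have hy : ofIntegral ℚ n (y ^ e) =
      ∑ t ∈ standardTableaux n, ((f t ^ e : ℤ) : ℚ) • jmIdempotent t := by
    rw [map_pow, ← mul_one (ofIntegral ℚ n y ^ e), ← sum_jmIdempotent, Finset.mul_sum]
    exact Finset.sum_congr rfl fun t ht => hpow t (mem_standardTableaux.1 ht) e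
  have hE : classIdempotentQ (u.cls p) = ∑ t ∈ standardTableaux n,
      (((if Equivalent p u t then 1 else 0 : ℤ)) : ℚ) • jmIdempotent t := by
    have : u.cls p = (standardTableaux n).filter fun t => Equivalent p u t := by
      ext t; simp [mem_cls, mem_standardTableaux]
    rw [classIdempotentQ, this, Finset.sum_filter]
    refine Finset.sum_congr rfl fun t _ => ?_
    split_ifs <;> simp
  have hdvd : ∀ t ∈ standardTableaux n,
      ((p ^ M : ℕ) : ℤ) ∣ (if Equivalent p u t then 1 else 0) - f t ^ e := by
    intro t ht
    split_ifs with h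
    · exact (exists_pow_dvd (f t) M).1 (h2 t h)
    · rw [zero_sub, dvd_neg]
      exact (exists_pow_dvd (f t) M).2 (h3 t (by simp [ht, h]))
  choose! c hc using hdvd
  choose z hz using hM
  refine ⟨ofIntegral (ZMod p) n (y ^ e) + ∑ t ∈ standardTableaux n, (c t : ZMod p) • z t, ?_⟩
  have : classIdempotentQ (u.cls p) = ofIntegral ℚ n (y ^ e) +
      ∑ t ∈ standardTableaux n, (c t : ℚ) • ((p ^ M : ℕ) : ℚ) • jmIdempotent t := by
    rw [hy, hE, ← Finset.sum_add_distrib]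
    refine Finset.sum_congr rfl fun t ht => ?_
    have := congrArg (Int.cast : ℤ → ℚ) (hc t ht)
    rw [smul_smul, ← add_smul]
    congr 1
    push_cast at this ⊢
    linear_combination this
  rw [this]
  exact (reduces_ofIntegral _).add (Reduces.sum _ fun t _ => (hz t).intSMul _)

theorem classIdempotentQ_reduces (u : Tableau n) :
    Reduces p (classIdempotentQ (u.cls p)) (classIdempotent p (u.cls p)) := by
  obtain ⟨z, hz⟩ := exists_classIdempotentQ_reduces (p := p) u
  rw [classIdempotent, hz.reduceMod_eq]
  exact hz

end Classes

/-! ### Two general facts on generalized eigenvalues. -/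

section Abstract

variable {K A : Type*} [Field K] [Ring A] [Algebra K A]

/-- Uniqueness in the Sylvester equation: if `X` and `Y` have the different generalized eigenvalues
`a` and `b`, then nothing intertwines them. -/
theorem eq_zero_of_intertwines {X Y e x : A} {a b : K} (hab : a ≠ b) {m m' : ℕ}
    (hY : Commute e Y) (hex : e * x = x) (hxe : x * e = x) (hx : X * x = x * Y)
    (ha : (X - algebraMap K A a) ^ m * e = 0) (hb : (Y - algebraMap K A b) ^ m' * e = 0) :
    x = 0 := by
  have h1 : ∀ k : ℕ, (X - algebraMap K A a) ^ k * x = x * (Y - algebraMap K A a) ^ k := by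
    intro k
    have h : SemiconjBy x (Y - algebraMap K A a) (X - algebraMap K A a) := by
      rw [SemiconjBy, mul_sub, sub_mul, hx, Algebra.commutes]
    exact (h.pow_right k).symm
  have h2 : x * (Y - algebraMap K A a) ^ m = 0 := by
    rw [← h1, ← hex, ← mul_assoc, ha, zero_mul]
  have h3 : x * (Y - algebraMap K A b) ^ m' = 0 := by
    have : Commute e ((Y - algebraMap K A b) ^ m') :=
      (hY.sub_right (Algebra.commutes b e).symm).pow_right m'
    rw [← hxe, mul_assoc, this.eq, hb, mul_zero]
  -- `x` is killed on the right by `(Y - a)^m` and by `(Y - b)^m'`; evaluating a Bézout relation at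
  -- `Y` gives `x = 0`.
  have hc : IsCoprime ((Polynomial.X - Polynomial.C a) ^ m)
      ((Polynomial.X - Polynomial.C b) ^ m') :=
    (Polynomial.isCoprime_X_sub_C_of_isUnit_sub (sub_ne_zero.2 hab).isUnit).pow
  obtain ⟨f, g, hfg⟩ := hc
  have h4 := congrArg (Polynomial.aeval Y) hfg
  rw [mul_comm f, mul_comm g] at h4
  simp only [map_add, map_mul, map_pow, map_sub, map_one, Polynomial.aeval_X,
    Polynomial.aeval_C] at h4
  rw [← mul_one x, ← h4, mul_add, ← mul_assoc, ← mul_assoc, h2, h3, zero_mul, zero_mul, add_zero]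

theorem exists_pow_sub_mul_eq_zero {X Y e : A} (he : e * e = e) (hXe : Commute X e)
    (hYe : Commute Y e) (hXY : Commute X Y) {m m' : ℕ} (hX : X ^ m * e = 0) (hY : Y ^ m' * e = 0) :
    ∃ k, (X - Y) ^ k * e = 0 := by
  have hnil : ∀ {Z : A} {r : ℕ}, Commute Z e → Z ^ r * e = 0 → IsNilpotent (Z * e) := by
    intro Z r hZ h
    -- The extra factor guarantees that a factor `e` is present even when `r = 0`.
    refine ⟨r + 1, ?_⟩
    rw [hZ.mul_pow, pow_succ', mul_assoc, pow_succ e, ← mul_assoc (Z ^ r),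
      ((hZ.pow_left r).pow_right r).eq, mul_assoc, h, mul_zero, mul_zero]
  have hc : Commute (X * e) (Y * e) :=
    (hXY.mul_right hXe).mul_left (hYe.symm.mul_right (Commute.refl e))
  obtain ⟨k, hk⟩ := hc.isNilpotent_sub (hnil hXe hX) (hnil hYe hY)
  rw [← sub_mul, (hXe.sub_left hYe).mul_pow] at hk
  have hek : e ^ k * e = e := by
    clear hk
    induction k with
    | zero => simp
    | succ k ih => rw [pow_succ, mul_assoc, he, ih]
  exact ⟨k, by rw [← hek, ← mul_assoc, hk, zero_mul]⟩

end Abstract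

/-! ### The class idempotents over `𝔽_p`, and the intertwining relation. -/

section ModP

open Tableau

variable {n : ℕ} {p : ℕ} [Fact p.Prime]

theorem classIdempotent_mul_self (u : Tableau n) :
    classIdempotent p (u.cls p) * classIdempotent p (u.cls p) = classIdempotent p (u.cls p) := by
  classical
  have h := (classIdempotentQ_reduces (p := p) u).mul (classIdempotentQ_reduces u)
  rw [classIdempotentQ_mul (cls_subset u) (cls_subset u), Finset.inter_self] at h
  exact h.unique (classIdempotentQ_reduces u)

theorem classIdempotent_mul_of_not_equivalent {u v : Tableau n} (h : ¬ Equivalent p u v) :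
    classIdempotent p (u.cls p) * classIdempotent p (v.cls p) = 0 := by
  classical
  have hr := (classIdempotentQ_reduces (p := p) u).mul (classIdempotentQ_reduces v)
  have : u.cls p ∩ v.cls p = ∅ := by
    ext t
    simp only [Finset.mem_inter, mem_cls, Finset.notMem_empty, iff_false]
    exact fun ht => h (ht.1.2.trans ht.2.2.symm)
  rw [classIdempotentQ_mul (cls_subset u) (cls_subset v), this, classIdempotentQ,
    Finset.sum_empty] at hr
  exact hr.unique .zero

theorem sum_classIdempotent (p n : ℕ) [Fact p.Prime] :
    ∑ U ∈ tableauClasses p n, classIdempotent p U = 1 := by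
  have h := Reduces.sum (p := p) (tableauClasses p n) (f := classIdempotentQ)
    (g := classIdempotent p) fun U hU => by
      obtain ⟨u, -, rfl⟩ := mem_tableauClasses.1 hU
      exact classIdempotentQ_reduces u
  rw [sum_classIdempotentQ] at h
  exact h.unique .one

theorem jucysMurphy_commute_classIdempotent (u : Tableau n) (k : Fin n) :
    Commute (jucysMurphy (ZMod p) k) (classIdempotent p (u.cls p)) := by
  have h := (classIdempotentQ_reduces (p := p) u).mul (.jucysMurphy k)
  rw [(classIdempotentQ_commute (cls_subset u) k).eq] at h
  exact ((Reduces.jucysMurphy k).mul (classIdempotentQ_reduces u)).unique h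

theorem hL_commute_classIdempotent (u : Tableau n) (i : Fin (n - 1)) :
    Commute (hL p i) (classIdempotent p (u.cls p)) :=
  (jucysMurphy_commute_classIdempotent u _).sub_left (jucysMurphy_commute_classIdempotent u _)

/-- The Jucys-Murphy elements have the residues of the contents as generalized eigenvalues. -/
theorem exists_pow_jucysMurphy_sub_mul_eq_zero (u : Tableau n) (k : Fin n) :
    ∃ m, (jucysMurphy (ZMod p) k - algebraMap (ZMod p) _ ((u.content k : ℤ) : ZMod p)) ^ m *
      classIdempotent p (u.cls p) = 0 := by
  obtain ⟨M, hM⟩ := exists_pow_smul_jmIdempotent_reduces p n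
  choose z hz using hM
  -- All eigenvalues on the class are divisible by `p`: `M` factors `p` clear the denominators of
  -- the `E_t`, and the last one vanishes mod `p`.
  refine ⟨M + 1, ?_⟩
  have h1 := (((Reduces.jucysMurphy (p := p) k).sub (.intCast (u.content k))).pow (M + 1)).mul
    (classIdempotentQ_reduces u)
  refine h1.unique ?_
  have hdvd : ∀ t ∈ u.cls p, (p : ℤ) ∣ t.content k - u.content k := fun t ht =>
    Int.modEq_iff_dvd.1 ((mem_cls.1 ht).2 k)
  choose! c hc using hdvd
  have hpow : ∀ t : Tableau n, t.IsStandard → ∀ r : ℕ,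
      (jucysMurphy ℚ k - algebraMap ℚ _ ((u.content k : ℤ) : ℚ)) ^ r * jmIdempotent t =
        (((t.content k - u.content k) ^ r : ℤ) : ℚ) • jmIdempotent t := by
    intro t ht r
    induction r with
    | zero => simp
    | succ r ih =>
      rw [pow_succ, mul_assoc, sub_mul, jucysMurphy_mul_jmIdempotent ht, ← sub_mul, ← map_sub,
        ← Algebra.smul_def, mul_smul_comm, ih, smul_smul, pow_succ]
      push_cast; rw [mul_comm]
  have e : (jucysMurphy ℚ k - algebraMap ℚ _ ((u.content k : ℤ) : ℚ)) ^ (M + 1) *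
      classIdempotentQ (u.cls p) =
        ∑ t ∈ u.cls p, ((p * c t ^ (M + 1) : ℤ) : ℚ) • ((p ^ M : ℕ) : ℚ) • jmIdempotent t := by
    rw [classIdempotentQ, Finset.mul_sum]
    refine Finset.sum_congr rfl fun t ht => ?_
    rw [hpow t (mem_cls.1 ht).1, hc t ht, smul_smul]
    congr 1
    push_cast; ring
  rw [e]
  have h2 := Reduces.sum (p := p) (u.cls p) fun t _ => (hz t).intSMul (p * c t ^ (M + 1))
  simpa using h2

theorem classIdempotent_mul_simpleElt_mul {s t : Tableau n} (i : Fin (n - 1))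
    (h1 : ¬ Equivalent p s t) (h2 : ¬ Equivalent p s (t.act (simple i))) :
    classIdempotent p (s.cls p) * simpleElt (ZMod p) i * classIdempotent p (t.cls p) = 0 := by
  have h := ((classIdempotentQ_reduces (p := p) s).mul (.simpleElt i)).mul
    (classIdempotentQ_reduces t)
  refine h.unique ?_
  have e : classIdempotentQ (s.cls p) * simpleElt ℚ i * classIdempotentQ (t.cls p) = 0 := by
    rw [classIdempotentQ, classIdempotentQ, Finset.sum_mul, Finset.sum_mul]
    refine Finset.sum_eq_zero fun a ha => ?_
    rw [Finset.mul_sum]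
    refine Finset.sum_eq_zero fun b hb => ?_
    rw [mem_cls] at ha hb
    by_contra h0
    rcases content_of_jmIdempotent_mul_simpleElt_mul_ne_zero ha.1 hb.1 i h0 with h | h
    · refine h1 (ha.2.trans ?_)
      refine Equivalent.trans (fun k => ?_) hb.2.symm
      rw [h]
    · refine h2 (ha.2.trans ?_)
      refine Equivalent.trans (fun k => ?_) (hb.2.symm.act_simple i)
      rw [h, content_act]
      rfl
  rw [e]
  exact .zero

theorem eq_sum_classIdempotent_mul (x : MonoidAlgebra (ZMod p) (SymGrp n)) :
    x = ∑ U ∈ tableauClasses p n, classIdempotent p U * x := by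
  rw [← Finset.sum_mul, sum_classIdempotent, one_mul]

theorem eq_sum_mul_classIdempotent (x : MonoidAlgebra (ZMod p) (SymGrp n)) :
    x = ∑ U ∈ tableauClasses p n, x * classIdempotent p U := by
  rw [← Finset.mul_sum, sum_classIdempotent, mul_one]

/-- The swap does not leave the class, so all off-diagonal blocks vanish and both products equal the
diagonal block. -/
theorem classIdempotent_commute_simpleElt {u : Tableau n} (hu : u.IsStandard) (i : Fin (n - 1))
    (h : Equivalent p u (u.act (simple i))) :
    Commute (classIdempotent p (u.cls p)) (simpleElt (ZMod p) i) := by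
  have e1 : simpleElt (ZMod p) i * classIdempotent p (u.cls p) =
      classIdempotent p (u.cls p) * simpleElt (ZMod p) i * classIdempotent p (u.cls p) := by
    rw [eq_sum_classIdempotent_mul (simpleElt (ZMod p) i * _),
      Finset.sum_eq_single_of_mem _ (cls_mem_tableauClasses hu), mul_assoc]
    intro S hS hne
    obtain ⟨s, hs, rfl⟩ := mem_tableauClasses.1 hS
    have hn : ¬ Equivalent p s u := fun h' => hne ((cls_eq_iff hu).2 h')
    rw [← mul_assoc]
    exact classIdempotent_mul_simpleElt_mul i hn fun h' => hn (h'.trans h.symm)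
  have e2 : classIdempotent p (u.cls p) * simpleElt (ZMod p) i =
      classIdempotent p (u.cls p) * simpleElt (ZMod p) i * classIdempotent p (u.cls p) := by
    conv_lhs => rw [eq_sum_mul_classIdempotent (_ * simpleElt (ZMod p) i)]
    rw [Finset.sum_eq_single_of_mem _ (cls_mem_tableauClasses hu)]
    intro S hS hne
    obtain ⟨s, hs, rfl⟩ := mem_tableauClasses.1 hS
    have hn : ¬ Equivalent p s u := fun h' => hne ((cls_eq_iff hu).2 h')
    refine classIdempotent_mul_simpleElt_mul i (fun h' => hn h'.symm) fun h' => hn ?_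
    have := h'.act_simple i
    rw [act_simple_act_simple] at this
    exact this.symm.trans h.symm
  exact e2.trans e1.symm

/-! ### The inverse of `hL` -/

/-- Write `x = α (1 - y)`; the geometric sum telescopes to `1 - y^m`, and `y^m` kills `v`. -/
theorem hL_mul_geomInverse_mul {x v : MonoidAlgebra (ZMod p) (SymGrp n)} {α : ZMod p} (hα : α ≠ 0)
    {m : ℕ} (hv : (x - algebraMap (ZMod p) _ α) ^ m * v = 0) :
    x * (geomInverse p x α m * v) = v := by
  set y := α⁻¹ • (algebraMap (ZMod p) _ α - x) with hy
  have hx : x = α • (1 - y) := by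
    rw [hy, smul_sub, smul_smul, mul_inv_cancel₀ hα, one_smul, ← Algebra.algebraMap_eq_smul_one,
      sub_sub_cancel]
  have hg : geomInverse p x α m = α⁻¹ • ∑ i ∈ Finset.range m, y ^ i := by
    rw [geomInverse, Finset.smul_sum]
    refine Finset.sum_congr rfl fun i _ => ?_
    rw [hy, smul_pow, smul_smul, pow_succ']
  have hym : y ^ m * v = 0 := by
    rw [hy, smul_pow, ← neg_sub, neg_pow, smul_mul_assoc, mul_assoc, hv, mul_zero, smul_zero]
  have hxg : x * geomInverse p x α m = 1 - y ^ m := by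
    rw [hg, mul_smul_comm, ← mul_neg_geom_sum]
    nth_rewrite 1 [hx]
    rw [smul_mul_assoc, smul_smul, inv_mul_cancel₀ hα, one_smul]
  rw [← mul_assoc, hxg, sub_mul, one_mul, hym, sub_zero]

theorem commute_geomInverse {x y : MonoidAlgebra (ZMod p) (SymGrp n)} (h : Commute y x)
    (α : ZMod p) (m : ℕ) : Commute y (geomInverse p x α m) :=
  Commute.sum_right _ _ _ fun i _ =>
    (((show Commute y _ from (Algebra.commutes α y).symm).sub_right h).pow_right i).smul_right _

theorem jucysMurphy_commute_hL (k : Fin n) (i : Fin (n - 1)) :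
    Commute (jucysMurphy (ZMod p) k) (hL p i) :=
  (commute_jucysMurphy _ _).sub_right (commute_jucysMurphy _ _)

theorem jucysMurphy_commute_invHL (k : Fin n) (i : Fin (n - 1)) :
    Commute (jucysMurphy (ZMod p) k) (invHL p i) := by
  refine Commute.sum_right _ _ _ fun T hT => ?_
  obtain ⟨t, -, rfl⟩ := mem_tableauClasses.1 (Finset.mem_filter.1 hT).1
  exact (commute_geomInverse (jucysMurphy_commute_hL k i) _ _).mul_right
    (jucysMurphy_commute_classIdempotent t k)

theorem classIdempotent_commute_invHL (u : Tableau n) (i : Fin (n - 1)) :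
    Commute (classIdempotent p (u.cls p)) (invHL p i) := by
  refine Commute.sum_right _ _ _ fun T hT => ?_
  obtain ⟨t, -, rfl⟩ := mem_tableauClasses.1 (Finset.mem_filter.1 hT).1
  refine (commute_geomInverse (hL_commute_classIdempotent u i).symm _ _).mul_right ?_
  by_cases h : Equivalent p u t
  · have : u.cls p = t.cls p := by
      ext w
      rw [mem_cls, mem_cls]
      exact and_congr_right fun _ => ⟨h.symm.trans, h.trans⟩
    rw [this]
    exact Commute.refl _
  · rw [Commute, SemiconjBy, classIdempotent_mul_of_not_equivalent h,
      classIdempotent_mul_of_not_equivalent fun h' => h h'.symm]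

theorem classStep_cls {u : Tableau n} (hu : u.IsStandard) (i : Fin (n - 1)) :
    classStep p (u.cls p) i = ((u.content (hi i) - u.content (lo i) : ℤ) : ZMod p) := by
  have hne : (u.cls p).Nonempty := ⟨u, mem_cls.2 ⟨hu, .refl u⟩⟩
  have hc : ∀ k, ((classContent (u.cls p) k : ℤ) : ZMod p) = (u.content k : ℤ) := by
    intro k
    rw [classContent, dif_pos hne, ZMod.intCast_eq_intCast_iff]
    exact ((mem_cls.1 hne.choose_spec).2 k).symm
  rw [classStep, Int.cast_sub, hc, hc, Int.cast_sub]

theorem mem_classSpace {u : Tableau n} {x : MonoidAlgebra (ZMod p) (SymGrp n)} :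
    x ∈ classSpace p (u.cls p) ↔ classIdempotent p (u.cls p) * x = x := by
  constructor
  · rintro ⟨y, rfl⟩
    rw [LinearMap.mulLeft_apply, ← mul_assoc, classIdempotent_mul_self]
  · intro h
    exact ⟨x, h⟩

theorem exists_pow_hL_sub_mul_eq_zero (u : Tableau n) (i : Fin (n - 1)) :
    ∃ m, (hL p i - algebraMap (ZMod p) _ ((u.content (hi i) - u.content (lo i) : ℤ) : ZMod p)) ^ m *
      classIdempotent p (u.cls p) = 0 := by
  obtain ⟨m, hm⟩ := exists_pow_jucysMurphy_sub_mul_eq_zero (p := p) u (hi i)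
  obtain ⟨m', hm'⟩ := exists_pow_jucysMurphy_sub_mul_eq_zero (p := p) u (lo i)
  obtain ⟨k, hk⟩ := exists_pow_sub_mul_eq_zero (classIdempotent_mul_self u)
    ((jucysMurphy_commute_classIdempotent u _).sub_left (Algebra.commutes _ _))
    ((jucysMurphy_commute_classIdempotent u _).sub_left (Algebra.commutes _ _))
    (((commute_jucysMurphy _ _).sub_right (Algebra.commutes _ _).symm).sub_left
      (Algebra.commutes _ _)) hm hm'
  refine ⟨k, ?_⟩
  rw [← hk, hL, Int.cast_sub, map_sub]
  congr 2
  abel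

theorem nilIndex_spec {u : Tableau n} (i : Fin (n - 1)) {α : ZMod p}
    (hα : α = ((u.content (hi i) - u.content (lo i) : ℤ) : ZMod p))
    {v : MonoidAlgebra (ZMod p) (SymGrp n)} (hv : v ∈ classSpace p (u.cls p)) :
    (hL p i - algebraMap (ZMod p) _ α) ^ nilIndex p (hL p i) α (u.cls p) * v = 0 := by
  have hne : {m : ℕ | ∀ v ∈ classSpace p (u.cls p),
      (hL p i - algebraMap (ZMod p) (MonoidAlgebra (ZMod p) (SymGrp n)) α) ^ m * v = 0}.Nonempty := by
    obtain ⟨m, hm⟩ := exists_pow_hL_sub_mul_eq_zero (p := p) u i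
    refine ⟨m, fun v hv => ?_⟩
    rw [← mem_classSpace.1 hv, ← mul_assoc, hα, hm, zero_mul]
  exact Nat.sInf_mem hne v hv

theorem invHL_mul {u : Tableau n} (hu : u.IsStandard) (i : Fin (n - 1)) {α : ZMod p}
    (hα : α = ((u.content (hi i) - u.content (lo i) : ℤ) : ZMod p)) (h0 : α ≠ 0)
    {v : MonoidAlgebra (ZMod p) (SymGrp n)} (hv : v ∈ classSpace p (u.cls p)) :
    invHL p i * v = geomInverse p (hL p i) α (nilIndex p (hL p i) α (u.cls p)) * v := by
  have hs := (classStep_cls (p := p) hu i).trans hα.symm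
  rw [mem_classSpace] at hv
  rw [invHL, Finset.sum_mul, Finset.sum_eq_single_of_mem (u.cls p), mul_assoc, hv, hs]
  · exact Finset.mem_filter.2 ⟨cls_mem_tableauClasses hu, by rwa [hs]⟩
  · intro T hT hne
    obtain ⟨t, -, rfl⟩ := mem_tableauClasses.1 (Finset.mem_filter.1 hT).1
    rw [← hv, mul_assoc, ← mul_assoc (classIdempotent p _),
      classIdempotent_mul_of_not_equivalent fun h => hne ((cls_eq_iff hu).2 h), zero_mul, mul_zero]

theorem hL_mul_invHL_mul {u : Tableau n} (hu : u.IsStandard) (i : Fin (n - 1))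
    (h0 : ((u.content (hi i) - u.content (lo i) : ℤ) : ZMod p) ≠ 0)
    {v : MonoidAlgebra (ZMod p) (SymGrp n)} (hv : v ∈ classSpace p (u.cls p)) :
    hL p i * (invHL p i * v) = v := by
  rw [invHL_mul hu i rfl h0 hv]
  exact hL_mul_geomInverse_mul h0 (nilIndex_spec i rfl hv)

theorem hL_commute_invHL (i : Fin (n - 1)) : Commute (hL p i) (invHL p i) :=
  (jucysMurphy_commute_invHL _ i).sub_left (jucysMurphy_commute_invHL _ i)

/-- On a class with different residues at the two letters, the diagonal block of the simple
transposition is the inverse of `hL`. -/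
theorem classIdempotent_mul_simpleElt_mul_self {u : Tableau n} (hu : u.IsStandard) (i : Fin (n - 1))
    (h0 : ((u.content (hi i) - u.content (lo i) : ℤ) : ZMod p) ≠ 0) :
    classIdempotent p (u.cls p) * simpleElt (ZMod p) i * classIdempotent p (u.cls p) =
      invHL p i * classIdempotent p (u.cls p) := by
  set e := classIdempotent p (u.cls p) with he
  have hee : e * e = e := classIdempotent_mul_self u
  have hLe : ∀ k, Commute (jucysMurphy (ZMod p) k) e := jucysMurphy_commute_classIdempotent u
  have hIe : Commute e (invHL p i) := classIdempotent_commute_invHL u i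
  obtain ⟨m, hm⟩ := exists_pow_jucysMurphy_sub_mul_eq_zero (p := p) u (hi i)
  obtain ⟨m', hm'⟩ := exists_pow_jucysMurphy_sub_mul_eq_zero (p := p) u (lo i)
  have hab : ((u.content (hi i) : ℤ) : ZMod p) ≠ ((u.content (lo i) : ℤ) : ZMod p) := by
    rwa [Int.cast_sub, sub_ne_zero] at h0
  rw [← sub_eq_zero]
  -- Both sides solve `L_k x = x L_{k-1} + e`, so their difference intertwines `L_{k-1}` with `L_k`.
  refine eq_zero_of_intertwines (X := jucysMurphy (ZMod p) (hi i))
    (Y := jucysMurphy (ZMod p) (lo i)) (e := e) hab (hLe (lo i)).symm ?_ ?_ ?_ hm hm'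
  · rw [mul_sub, ← mul_assoc, ← mul_assoc, hee, ← mul_assoc, hIe.eq, mul_assoc _ e e, hee]
  · rw [sub_mul, mul_assoc _ e e, mul_assoc _ e e, hee]
  · have h1 : jucysMurphy (ZMod p) (hi i) * (e * simpleElt (ZMod p) i * e) =
        e * simpleElt (ZMod p) i * e * jucysMurphy (ZMod p) (lo i) + e := by
      have := simpleElt_mul_jucysMurphy_lo (K := ZMod p) i
      have h3 : e * simpleElt (ZMod p) i * e * jucysMurphy (ZMod p) (lo i) =
          e * (simpleElt (ZMod p) i * jucysMurphy (ZMod p) (lo i)) * e := by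
        simp only [mul_assoc, ← (hLe (lo i)).eq]
      rw [h3, this, mul_sub, sub_mul, mul_one, hee, sub_add_cancel, ← mul_assoc, ← mul_assoc,
        ← mul_assoc, (hLe (hi i)).eq]
    have h2 : jucysMurphy (ZMod p) (hi i) * (invHL p i * e) =
        invHL p i * e * jucysMurphy (ZMod p) (lo i) + e := by
      have h3 : hL p i * (invHL p i * e) = e :=
        hL_mul_invHL_mul hu i h0 (mem_classSpace.2 hee)
      rw [hL, sub_mul, sub_eq_iff_eq_add] at h3
      rw [h3, mul_assoc (invHL p i), ← (hLe (lo i)).eq, ← mul_assoc, ← mul_assoc,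
        (jucysMurphy_commute_invHL (lo i) i).eq, add_comm]
    rw [mul_sub, h1, h2, sub_mul]
    abel

theorem content_sub_ne_zero_of_not_equivalent {u : Tableau n} {i : Fin (n - 1)}
    (h : ¬ Equivalent p u (u.act (simple i))) :
    ((u.content (hi i) - u.content (lo i) : ℤ) : ZMod p) ≠ 0 := by
  rw [Int.cast_sub, sub_ne_zero]
  intro e
  rw [ZMod.intCast_eq_intCast_iff] at e
  refine h fun k => ?_
  rw [content_act, Equiv.swap_apply_def]
  split_ifs with h1 h2
  · rw [h1]; exact e.symm
  · rw [h2]; exact e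
  · rfl

/-- The intertwining relation for one simple transposition. -/
theorem classIdempotent_mul_intertwiner {u : Tableau n} (hu : u.IsStandard) (i : Fin (n - 1))
    (hv : (u.act (simple i)).IsStandard) :
    classIdempotent p (u.cls p) * intertwiner p u i =
      intertwiner p u i * classIdempotent p ((u.act (simple i)).cls p) := by
  by_cases h : Equivalent p u (u.act (simple i))
  · rw [intertwiner, if_pos h, ← (cls_eq_iff hv).2 h, mul_sub, sub_mul, mul_one, one_mul]
    congr 1
    exact (classIdempotent_commute_simpleElt hu i h).eq
  · rw [intertwiner, if_neg h]
    change _ * (simpleElt (ZMod p) i - _) = (simpleElt (ZMod p) i - _) * _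
    have hu0 := content_sub_ne_zero_of_not_equivalent h
    set v := u.act (simple i) with hvdef
    have hvu : v.act (simple i) = u := act_simple_act_simple u i
    have hv0 : ((v.content (hi i) - v.content (lo i) : ℤ) : ZMod p) ≠ 0 :=
      content_sub_ne_zero_of_not_equivalent (by rw [hvu]; exact fun h' => h h'.symm)
    have hne : u.cls p ≠ v.cls p := fun e => h ((cls_eq_iff hv).1 e)
    have e1 : classIdempotent p (u.cls p) * simpleElt (ZMod p) i =
        classIdempotent p (u.cls p) * simpleElt (ZMod p) i * classIdempotent p (u.cls p) +
        classIdempotent p (u.cls p) * simpleElt (ZMod p) i * classIdempotent p (v.cls p) := by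
      conv_lhs => rw [eq_sum_mul_classIdempotent (_ * simpleElt (ZMod p) i)]
      refine Finset.sum_eq_add_of_mem _ _ (cls_mem_tableauClasses hu) (cls_mem_tableauClasses hv)
        hne ?_
      rintro S hS ⟨hSu, hSv⟩
      obtain ⟨s, hs, rfl⟩ := mem_tableauClasses.1 hS
      refine classIdempotent_mul_simpleElt_mul i (fun h' => hSu ((cls_eq_iff hu).2 h'.symm))
        fun h' => hSv ((cls_eq_iff hv).2 ?_)
      have := h'.act_simple i
      rw [act_simple_act_simple] at this
      exact this.symm
    have e2 : simpleElt (ZMod p) i * classIdempotent p (v.cls p) =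
        classIdempotent p (u.cls p) * simpleElt (ZMod p) i * classIdempotent p (v.cls p) +
        classIdempotent p (v.cls p) * simpleElt (ZMod p) i * classIdempotent p (v.cls p) := by
      conv_lhs => rw [eq_sum_classIdempotent_mul (simpleElt (ZMod p) i * _)]
      simp only [← mul_assoc]
      refine Finset.sum_eq_add_of_mem _ _ (cls_mem_tableauClasses hu) (cls_mem_tableauClasses hv)
        hne ?_
      rintro S hS ⟨hSu, hSv⟩
      obtain ⟨s, hs, rfl⟩ := mem_tableauClasses.1 hS
      refine classIdempotent_mul_simpleElt_mul i (fun h' => hSv ((cls_eq_iff hv).2 h'))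
        fun h' => hSu ((cls_eq_iff hu).2 ?_)
      rwa [hvu] at h'
    -- The subtracted `1 / h_L` cancels the diagonal block on each side, and both sides become the
    -- same off-diagonal block.
    rw [mul_sub, sub_mul, e1, e2, classIdempotent_mul_simpleElt_mul_self hu i hu0,
      classIdempotent_mul_simpleElt_mul_self hv i hv0, (classIdempotent_commute_invHL u i).eq]
    abel

/-- The intertwining relation along a word all of whose initial parts lead to standard tableaux. -/
theorem classIdempotent_mul_intertwinerProd (w : List (Fin (n - 1))) (u : Tableau n)
    (hu : ∀ w₁ w₂, w = w₁ ++ w₂ → (u.act (w₁.map simple).prod).IsStandard) :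
    classIdempotent p (u.cls p) * intertwinerProd p u w =
      intertwinerProd p u w * classIdempotent p ((u.act (w.map simple).prod).cls p) := by
  induction w generalizing u with
  | nil => simp [intertwinerProd, act_one]
  | cons i w ih =>
    have h1 : u.IsStandard := by simpa [act_one] using hu [] (i :: w) rfl
    have h2 : (u.act (simple i)).IsStandard := by simpa using hu [i] w rfl
    rw [intertwinerProd, ← mul_assoc, classIdempotent_mul_intertwiner h1 i h2, mul_assoc, ih,
      mul_assoc, act_act, List.map_cons, List.prod_cons]
    intro w₁ w₂ h
    rw [act_act, ← List.prod_cons, ← List.map_cons]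
    exact hu (i :: w₁) w₂ (by rw [h, List.cons_append])

end ModP

/-! ### Reduced words, inversions, and standardness along a reduced expression of `d(t)`. -/

section Words

variable {n : ℕ}

/-- The inversions of a permutation. -/
def inversions (h : Equiv.Perm (Fin n)) : Finset (Fin n × Fin n) :=
  Finset.univ.filter fun x => x.1 < x.2 ∧ h x.2 < h x.1

theorem mem_inversions {h : Equiv.Perm (Fin n)} {x : Fin n × Fin n} :
    x ∈ inversions h ↔ x.1 < x.2 ∧ h x.2 < h x.1 := by
  simp [inversions]

theorem swap_lt_swap (i : Fin (n - 1)) {a b : Fin n} (hab : a < b) (h : ¬ (a = lo i ∧ b = hi i)) :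
    Equiv.swap (lo i) (hi i) a < Equiv.swap (lo i) (hi i) b := by
  simp only [Equiv.swap_apply_def]
  split_ifs <;> simp only [lo, hi, Fin.lt_def, Fin.ext_iff] at * <;> omega

/-- Swapping the two adjacent positions matches the inversions of both permutations, except for the
pair of these positions itself. -/
theorem card_inversions_of_descent (h : Equiv.Perm (Fin n)) (i : Fin (n - 1))
    (hd : h (hi i) < h (lo i)) :
    (inversions h).card = (inversions (h * Equiv.swap (lo i) (hi i))).card + 1 := by
  have hm : (lo i, hi i) ∈ inversions h := mem_inversions.2 ⟨lo_lt_hi i, hd⟩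
  rw [← Finset.card_erase_add_one hm]
  congr 1
  set s := Equiv.swap (lo i) (hi i) with hs
  refine Finset.card_nbij' (fun x => (s x.1, s x.2)) (fun x => (s x.1, s x.2)) ?_ ?_ ?_ ?_
  · rintro ⟨a, b⟩ hx
    obtain ⟨hne, hx⟩ := Finset.mem_erase.1 hx
    obtain ⟨h1, h2⟩ := mem_inversions.1 hx
    refine mem_inversions.2 ⟨swap_lt_swap i h1 fun e => hne (Prod.ext e.1 e.2), ?_⟩
    simpa [hs] using h2
  · rintro ⟨a, b⟩ hx
    obtain ⟨h1, h2⟩ := mem_inversions.1 hx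
    refine Finset.mem_erase.2 ⟨fun e => ?_, mem_inversions.2 ⟨swap_lt_swap i h1 fun e => ?_, h2⟩⟩
    · rw [Prod.mk.injEq] at e
      have ea : a = hi i := by rw [← Equiv.swap_apply_left (lo i) (hi i), ← hs, ← e.1, hs]; simp
      have eb : b = lo i := by rw [← Equiv.swap_apply_right (lo i) (hi i), ← hs, ← e.2, hs]; simp
      rw [ea, eb] at h1
      exact lt_asymm h1 (lo_lt_hi i)
    · obtain ⟨ea, eb⟩ := e
      dsimp only at ea eb h2
      rw [ea, eb, hs] at h2
      simp only [Equiv.Perm.mul_apply, Equiv.swap_apply_left, Equiv.swap_apply_right] at h2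
      exact lt_asymm h2 hd
  · rintro ⟨a, b⟩ _; simp [hs]
  · rintro ⟨a, b⟩ _; simp [hs]

theorem card_inversions_of_not_descent (h : Equiv.Perm (Fin n)) (i : Fin (n - 1))
    (hd : ¬ h (hi i) < h (lo i)) :
    (inversions (h * Equiv.swap (lo i) (hi i))).card = (inversions h).card + 1 := by
  have := card_inversions_of_descent (h * Equiv.swap (lo i) (hi i)) i (by
    simpa using (not_lt.1 hd).lt_of_ne (h.injective.ne (lo_ne_hi i)))
  rwa [mul_assoc, Equiv.swap_mul_self, mul_one] at this

theorem eq_one_of_no_descent (h : Equiv.Perm (Fin n))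
    (hd : ∀ i : Fin (n - 1), ¬ h (hi i) < h (lo i)) : h = 1 := by
  have hmono : StrictMono h := by
    cases n with
    | zero => exact fun a => a.elim0
    | succ m =>
      refine Fin.strictMono_iff_lt_succ.2 fun i => ?_
      exact (not_lt.1 (hd i)).lt_of_ne (h.injective.ne (lo_ne_hi (n := m + 1) i))
  have := Subsingleton.elim (hmono.orderIsoOfSurjective h h.surjective) (OrderIso.refl _)
  exact Equiv.ext fun x => congrArg (fun f : Fin n ≃o Fin n => f x) this

/-- The reason for working with `g.unop⁻¹`: appending a letter to a word becomes right composition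
with a swap of positions. -/
theorem unop_mul_simple_inv (g : SymGrp n) (i : Fin (n - 1)) :
    (g * simple i).unop⁻¹ = g.unop⁻¹ * Equiv.swap (lo i) (hi i) := by
  rw [MulOpposite.unop_mul, mul_inv_rev, simple, MulOpposite.unop_op, Equiv.swap_inv]

theorem mul_simple_mul_simple (g : SymGrp n) (i : Fin (n - 1)) :
    g * simple i * simple i = g := by
  rw [mul_assoc, simple, swap_op_mul_self, mul_one]

theorem card_inversions_le_length (w : List (Fin (n - 1))) :
    (inversions (w.map simple).prod.unop⁻¹).card ≤ w.length := by
  induction w using List.reverseRecOn with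
  | nil =>
    have : inversions (1 : Equiv.Perm (Fin n)) = ∅ := by
      ext x
      simp only [mem_inversions, Equiv.Perm.one_apply, Finset.notMem_empty, iff_false]
      exact fun h => lt_asymm h.1 h.2
    simp [this]
  | append_singleton w i ih =>
    rw [List.map_append, List.prod_append, List.map_singleton, List.prod_singleton,
      unop_mul_simple_inv, List.length_append, List.length_singleton]
    by_cases hd : (w.map simple).prod.unop⁻¹ (hi i) < (w.map simple).prod.unop⁻¹ (lo i)
    · have := card_inversions_of_descent _ i hd
      omega
    · rw [card_inversions_of_not_descent _ i hd]
      omega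

theorem exists_word_length_le (g : SymGrp n) :
    ∃ w : List (Fin (n - 1)), (w.map simple).prod = g ∧
      w.length ≤ (inversions g.unop⁻¹).card := by
  obtain ⟨d, hd⟩ : ∃ d, d = (inversions g.unop⁻¹).card := ⟨_, rfl⟩
  induction d generalizing g with
  | zero =>
    have h1 : g.unop⁻¹ = 1 := by
      refine eq_one_of_no_descent _ fun i h => ?_
      have := card_inversions_of_descent _ i h
      omega
    refine ⟨[], ?_, Nat.zero_le _⟩
    rw [inv_eq_one, MulOpposite.unop_eq_one_iff] at h1
    simp [h1]
  | succ d ih =>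
    by_cases h : ∃ i, g.unop⁻¹ (hi i) < g.unop⁻¹ (lo i)
    · obtain ⟨i, h⟩ := h
      have e := card_inversions_of_descent _ i h
      rw [← unop_mul_simple_inv] at e
      obtain ⟨w, hw, hl⟩ := ih (g * simple i) (by omega)
      refine ⟨w ++ [i], ?_, ?_⟩
      · rw [List.map_append, List.prod_append, hw, List.map_singleton, List.prod_singleton,
          mul_simple_mul_simple]
      · rw [List.length_append, List.length_singleton]
        omega
    · have h1 := eq_one_of_no_descent _ (not_exists.1 h)
      refine ⟨[], ?_, Nat.zero_le _⟩
      rw [inv_eq_one, MulOpposite.unop_eq_one_iff] at h1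
      simp [h1]

namespace IsReducedWord

variable {w : List (Fin (n - 1))} {g : SymGrp n} {i : Fin (n - 1)}

theorem of_append_singleton (h : IsReducedWord (w ++ [i]) g) : IsReducedWord w (g * simple i) := by
  obtain ⟨h1, h2⟩ := h
  rw [List.map_append, List.prod_append, List.map_singleton, List.prod_singleton] at h1
  refine ⟨by rw [← h1, mul_simple_mul_simple], fun w' hw' => ?_⟩
  have := h2 (w' ++ [i]) (by
    rw [List.map_append, List.prod_append, hw', List.map_singleton, List.prod_singleton,
      mul_simple_mul_simple])
  simpa using this

/-- Otherwise `g σ` has one inversion more than `g`, so `w` is longer than the inversion number of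
`g`, although `g` has a word of at most that length. -/
theorem descent (h : IsReducedWord (w ++ [i]) g) : g.unop⁻¹ (hi i) < g.unop⁻¹ (lo i) := by
  by_contra hd
  have e := card_inversions_of_not_descent _ i hd
  rw [← unop_mul_simple_inv, ← h.of_append_singleton.1] at e
  have h1 := card_inversions_le_length w
  obtain ⟨w', hw', hl⟩ := exists_word_length_le g
  have h2 := h.2 w' hw'
  rw [List.length_append, List.length_singleton] at h2
  omega

end IsReducedWord

namespace Tableau

theorem readingEntry_lt (t : Tableau n) {x y : {x // x ∈ t.shape.cells}}
    (h : y.1 = (x.1.1, x.1.2 + 1) ∨ y.1 = (x.1.1 + 1, x.1.2)) :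
    t.readingEntry x < t.readingEntry y := by
  unfold readingEntry
  rw [Equiv.trans_apply, Equiv.trans_apply]
  refine ((readingCells t.shape).orderIsoOfFin
    (by simpa [readingCells] using t.card_cells)).symm.lt_iff_lt.2 ?_
  change toLex x.1 < toLex y.1
  rw [Prod.Lex.toLex_lt_toLex]
  rcases h with h | h <;> rw [h] <;> simp

theorem unop_d_inv (t : Tableau n) (k : Fin n) :
    t.d.unop⁻¹ k = t.readingEntry (t.entry.symm k) := rfl

/-- Exchanging neighbouring letters that stand in decreasing order of reading preserves
standardness. -/
theorem IsStandard.act_simple {t : Tableau n} (ht : t.IsStandard) {i : Fin (n - 1)}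
    (hd : t.d.unop⁻¹ (hi i) < t.d.unop⁻¹ (lo i)) : (t.act (simple i)).IsStandard := by
  intro (x : {x // x ∈ t.shape.cells}) (y : {x // x ∈ t.shape.cells}) hxy
  have h1 : t.entry x < t.entry y := by
    refine (ht x y hxy).lt_of_ne fun e => ?_
    rw [t.entry.injective e] at hxy
    rcases hxy with h | h
    · have := congrArg Prod.snd h; simp at this
    · have := congrArg Prod.fst h; simp at this
  refine (swap_lt_swap i h1 ?_).le
  rintro ⟨h2, h3⟩
  rw [unop_d_inv, unop_d_inv, ← h2, ← h3, Equiv.symm_apply_apply, Equiv.symm_apply_apply] at hd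
  exact lt_asymm hd (t.readingEntry_lt hxy)

/-- Initial parts of a reduced expression of `d(t)` lead to standard tableaux. -/
theorem IsStandard.highest_act {t : Tableau n} (ht : t.IsStandard) (w₁ w₂ : List (Fin (n - 1)))
    (hw : IsReducedWord (w₁ ++ w₂) t.d) : (t.highest.act (w₁.map simple).prod).IsStandard := by
  induction w₂ using List.reverseRecOn generalizing t with
  | nil =>
    rw [List.append_nil] at hw
    rwa [hw.1, highest_act_d]
  | append_singleton w₂ i ih =>
    rw [← List.append_assoc] at hw
    -- `t σ` has the same shape as `t`, hence the same `t^λ`, and `d(t σ) = d(t) σ` by definition.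
    exact ih (t := t.act (simple i)) (ht.act_simple hw.descent) hw.of_append_singleton

end Tableau

end Words

end ModularMurphy

open ModularMurphy in
theorem mainTheorem5 (p : ℕ) [Fact p.Prime] (n : ℕ)
    (t : Tableau n) (ht : t.IsStandard)
    (w : List (Fin (n - 1))) (hw : IsReducedWord w t.d) :
    -- the elements `E_U` can be reduced mod `p`
    (∀ U ∈ tableauClasses p n, IsPIntegral p (classIdempotentQ U)) ∧
    -- `h_L` minus a nonzero scalar is nilpotent on `E_U 𝔽_p S_n`, where `1 / h_L` is the geometric
    -- series and a two-sided inverse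
    (∀ u : Tableau n, u.IsStandard → ∀ i : Fin (n - 1), ∀ α : ZMod p,
      α = ((u.content (hi i) - u.content (lo i) : ℤ) : ZMod p) → α ≠ 0 →
      ∃ m : ℕ, ∀ v ∈ classSpace p (u.cls p),
        (hL p i - algebraMap (ZMod p) (MonoidAlgebra (ZMod p) (SymGrp n)) α) ^ m * v = 0 ∧
        invHL p i * v = geomInverse p (hL p i) α m * v ∧
        hL p i * v ∈ classSpace p (u.cls p) ∧
        invHL p i * v ∈ classSpace p (u.cls p) ∧
        hL p i * (invHL p i * v) = v ∧ invHL p i * (hL p i * v) = v) ∧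
    -- the product along the word makes sense step by step
    (∀ (w₁ : List (Fin (n - 1))) (i : Fin (n - 1)) (w₂ : List (Fin (n - 1))), w = w₁ ++ i :: w₂ →
      ∀ u v : Tableau n, u = t.highest.act (w₁.map simple).prod → v = u.act (simple i) →
        u.IsStandard ∧ v.IsStandard ∧
        (u.cls p ≠ v.cls p → ((v.content (hi i) - v.content (lo i) : ℤ) : ZMod p) ≠ 0) ∧
        (∀ x ∈ classSpace p (v.cls p), intertwiner p u i * x ∈ classSpace p (u.cls p))) ∧
    -- the intertwining relation
    classIdempotent p (t.highest.cls p) * intertwinerProd p t.highest w =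
      intertwinerProd p t.highest w * classIdempotent p (t.cls p) := by
  refine ⟨?_, ?_, ?_, ?_⟩
  · intro U hU
    obtain ⟨u, -, rfl⟩ := mem_tableauClasses.1 hU
    exact (classIdempotentQ_reduces u).isPIntegral
  · intro u hu i α hα h0
    -- The cut-off must be the one built into `invHL`, so that the geometric series agree term by
    -- term.
    refine ⟨nilIndex p (hL p i) α (u.cls p), fun v hv => ?_⟩
    have h1 := hL_mul_invHL_mul hu i (hα ▸ h0) hv
    have hv' := mem_classSpace.1 hv
    refine ⟨nilIndex_spec i hα hv, invHL_mul hu i hα h0 hv, ?_, ?_, h1, ?_⟩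
    · rw [mem_classSpace, ← mul_assoc, ← (hL_commute_classIdempotent u i).eq, mul_assoc, hv']
    · rw [mem_classSpace, ← mul_assoc, (classIdempotent_commute_invHL u i).eq, mul_assoc, hv']
    · rw [← mul_assoc, ← (hL_commute_invHL i).eq, mul_assoc, h1]
  · rintro w₁ i w₂ rfl u v rfl rfl
    have hu := ht.highest_act w₁ (i :: w₂) hw
    have hv : ((t.highest.act (w₁.map simple).prod).act (simple i)).IsStandard := by
      have := ht.highest_act (w₁ ++ [i]) w₂ (by simpa using hw)
      rwa [List.map_append, List.prod_append, List.map_singleton, List.prod_singleton,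
        ← act_act] at this
    refine ⟨hu, hv, fun hne => ?_, fun x hx => ?_⟩
    · refine content_sub_ne_zero_of_not_equivalent fun h => hne ?_
      rw [act_simple_act_simple] at h
      exact (Tableau.cls_eq_iff hv).2 h.symm
    · rw [mem_classSpace] at hx ⊢
      rw [← mul_assoc, classIdempotent_mul_intertwiner hu i hv, mul_assoc, hx]
  · have := classIdempotent_mul_intertwinerProd (p := p) w t.highest
      fun w₁ w₂ h => ht.highest_act w₁ w₂ (h ▸ hw)
    rwa [hw.1, Tableau.highest_act_d] at this
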